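/- Let $d\ge 1$, let $R=\mathbb C[x_1,\dots,x_d]$, and let $\mathbb C\{x\}=\mathbb C\{x_1,\dots,x_d\}$ be the ring of convergent power series at $0\in\mathbb C^d$. For $f\in R$ and $n\ge 1$, regard $R$ as a $\mathbb C[t]$-algebra via $t\mapsto f$, let $I$ be the kernel of the multiplication map $R\otimes_{\mathbb C[t]}R\to R$, and put $\Omega_f^{(n)}=I/I^{n+1}$, an $R$-module through $\xi\mapsto \xi\otimes 1$. The $n$-th Jacobian ideal $\mathcal J_n(f)\subseteq R$ is the $r$-th Fitting ideal of $\Omega_f^{(n)}$, where $r=\binom{d-1+n}{d-1}-1$. The $n$-th Nash blowup local algebra of $f$ is $\mathcal M_n(f)=\mathbb C\{x\}/\langle f,\mathcal J_n(f)\rangle$. Let $\mathrm{Jac}_n(f)$ be the matrix with rows indexed by the $\beta\in\mathbb N^d$ with $0\le|\beta|\le n-1$ and columns indexed by the $\alpha\in\mathbb N^d$ with $1\le|\alpha|\le n$, whose $(\beta,\alpha)$ entry is $\frac{1}{(\alpha-\beta)!}\partial^{\alpha-\beta}f$ if $\beta_i\le\alpha_i$ for all $i$ and $\beta\ne\alpha$,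 and $0$ otherwise. Polynomials $f,g$ are contact equivalent at $0$ if $g=u\cdot\varphi(f)$ for some unit $u$ of $\mathbb C\{x\}$ and some $\mathbb C$-algebra automorphism $\varphi$ of $\mathbb C\{x\}$. The hypersurface $V(f)$ has an isolated singularity at $0$ if $0$ is an isolated point of $\{z\in\mathbb C^d : f(z)=0,\ \partial f/\partial x_i(z)=0 \text{ for all } i\}$. **Theorem.** Let $f,g\in\mathbb C[x_1,\dots,x_d]$ be such that $V(f)$ and $V(g)$ have an isolated singularity at $0$. If $f$ is contact equivalent to $g$ at $0$, then for every $n\ge 1$ the $\mathbb C$-algebras $\mathcal M_n(f)$ and $\mathcal M_n(g)$ are isomorphic. The same holds if, in the definition of $\mathcal M_n$, the ideal $\mathcal J_n(f)$ is replaced by the ideal of $\mathbb C\{x\}$ generated by the maximal minors of $\mathrm{Jac}_n(f)$ (and likewise for $g$). -/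

import Mathlib

open scoped TensorProduct Topology

noncomputable section

namespace HigherNash

/-! ## The ring of convergent power series in `d` complex variables -/

/-- A formal power series is convergent if it converges absolutely on some polydisc around `0`. -/
def IsConvergent {d : ℕ} (p : MvPowerSeries (Fin d) ℂ) : Prop :=
  ∃ r : ℝ, 0 < r ∧ Summable fun a : Fin d →₀ ℕ => ‖MvPowerSeries.coeff a p‖ * r ^ a.degree

theorem IsConvergent.mono {d : ℕ} {p : MvPowerSeries (Fin d) ℂ} {r s : ℝ} (hs : 0 < s)
    (hsr : s ≤ r)
    (h : Summable fun a : Fin d →₀ ℕ => ‖MvPowerSeries.coeff a p‖ * r ^ a.degree) :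
    Summable fun a : Fin d →₀ ℕ => ‖MvPowerSeries.coeff a p‖ * s ^ a.degree := by
  refine h.of_nonneg_of_le (fun a => by positivity) (fun a => ?_)
  gcongr

theorem IsConvergent.add {d : ℕ} {p q : MvPowerSeries (Fin d) ℂ} (hp : IsConvergent p)
    (hq : IsConvergent q) : IsConvergent (p + q) := by
  obtain ⟨r, hr, hp⟩ := hp
  obtain ⟨s, hs, hq⟩ := hq
  have ht : 0 < min r s := lt_min hr hs
  refine ⟨min r s, ht, ?_⟩
  refine ((IsConvergent.mono ht (min_le_left r s) hp).add
    (IsConvergent.mono ht (min_le_right r s) hq)).of_nonneg_of_le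
      (fun a => by positivity) (fun a => ?_)
  rw [map_add, ← add_mul]
  gcongr
  exact norm_add_le _ _

theorem summable_antidiagonal {d : ℕ} {u v : (Fin d →₀ ℕ) → ℝ} (hu : Summable u)
    (hv : Summable v) (hu0 : 0 ≤ u) (hv0 : 0 ≤ v) :
    Summable fun a : Fin d →₀ ℕ =>
      ∑ x ∈ Finset.HasAntidiagonal.antidiagonal a, u x.1 * v x.2 :=
  summable_sum_mul_antidiagonal_of_summable_mul (hu.mul_of_nonneg hv hu0 hv0)

theorem norm_coeff_mul_le {d : ℕ} (p q : MvPowerSeries (Fin d) ℂ) (t : ℝ) (ht : 0 < t)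
    (a : Fin d →₀ ℕ) :
    ‖MvPowerSeries.coeff a (p * q)‖ * t ^ a.degree ≤
      ∑ x ∈ Finset.HasAntidiagonal.antidiagonal a,
        (‖MvPowerSeries.coeff x.1 p‖ * t ^ x.1.degree) *
          (‖MvPowerSeries.coeff x.2 q‖ * t ^ x.2.degree) := by
  classical
  rw [MvPowerSeries.coeff_mul]
  refine (mul_le_mul_of_nonneg_right (norm_sum_le _ _) (by positivity)).trans ?_
  rw [Finset.sum_mul]
  refine Finset.sum_le_sum fun x hx => ?_
  rw [Finset.HasAntidiagonal.mem_antidiagonal] at hx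
  have hd : a.degree = x.1.degree + x.2.degree := by rw [← hx, map_add]
  rw [hd, pow_add, norm_mul]
  exact le_of_eq (mul_mul_mul_comm _ _ _ _)

theorem IsConvergent.mul {d : ℕ} {p q : MvPowerSeries (Fin d) ℂ} (hp : IsConvergent p)
    (hq : IsConvergent q) : IsConvergent (p * q) := by
  obtain ⟨r, hr, hp⟩ := hp
  obtain ⟨s, hs, hq⟩ := hq
  have ht : 0 < min r s := lt_min hr hs
  have h := summable_antidiagonal (IsConvergent.mono ht (min_le_left r s) hp)
    (IsConvergent.mono ht (min_le_right r s) hq)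
    (fun a => by positivity) (fun a => by positivity)
  exact ⟨min r s, ht, h.of_nonneg_of_le (fun a => by positivity)
    (norm_coeff_mul_le p q _ ht)⟩

theorem isConvergent_coe {d : ℕ} (f : MvPolynomial (Fin d) ℂ) :
    IsConvergent (f : MvPowerSeries (Fin d) ℂ) := by
  refine ⟨1, one_pos, summable_of_ne_finset_zero (s := f.support) fun a ha => ?_⟩
  rw [MvPolynomial.notMem_support_iff] at ha
  simp [MvPolynomial.coeff_coe, ha]

/-- `ℂ{x₁, …, x_d}`: the `ℂ`-algebra of convergent power series, that is, of germs at the origin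
of complex analytic functions on `ℂ^d`. -/
def ConvergentSeries (d : ℕ) : Subalgebra ℂ (MvPowerSeries (Fin d) ℂ) where
  carrier := {p | IsConvergent p}
  mul_mem' := IsConvergent.mul
  add_mem' := IsConvergent.add
  algebraMap_mem' c := by
    have h := isConvergent_coe (MvPolynomial.C c : MvPolynomial (Fin d) ℂ)
    rwa [MvPolynomial.coe_C] at h

/-- The inclusion `ℂ[x₁, …, x_d] → ℂ{x₁, …, x_d}`. -/
def polyToSeries (d : ℕ) : MvPolynomial (Fin d) ℂ →ₐ[ℂ] ConvergentSeries d :=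
  (MvPolynomial.coeToMvPowerSeries.algHom ℂ).codRestrict (ConvergentSeries d) fun f => by
    have h : MvPolynomial.coeToMvPowerSeries.algHom ℂ f = (f : MvPowerSeries (Fin d) ℂ) := by
      ext a
      simp
    rw [h]
    exact isConvergent_coe f

/-- Contact equivalence of `f, g ∈ ℂ{x}`: `g = u · φ(f)` for a unit `u` and a `ℂ`-algebra
automorphism `φ` of `ℂ{x}`. -/
def ContactEquivalent {d : ℕ} (f g : ConvergentSeries d) : Prop :=
  ∃ (φ : ConvergentSeries d ≃ₐ[ℂ] ConvergentSeries d) (u : (ConvergentSeries d)ˣ),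
    g = (u : ConvergentSeries d) * φ f

/-- The hypersurface `V(f)` of a polynomial `f` has an isolated singularity at the origin:
the origin is a singular point of `V(f)`, and no other point near it is. -/
def HasIsolatedSingularity {d : ℕ} (f : MvPolynomial (Fin d) ℂ) : Prop :=
  (MvPolynomial.eval 0 f = 0 ∧ ∀ i, MvPolynomial.eval 0 (MvPolynomial.pderiv i f) = 0) ∧
  ∀ᶠ z : Fin d → ℂ in 𝓝[≠] 0,
    ¬ (MvPolynomial.eval z f = 0 ∧ ∀ i, MvPolynomial.eval z (MvPolynomial.pderiv i f) = 0)

/-! ## Multi-indices -/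

/-- The multi-indices `β` with `|β| < n`, that is, `0 ≤ |β| ≤ n - 1`. -/
abbrev RowIndex (d n : ℕ) : Type := {b : Fin d →₀ ℕ // b.degree < n}

/-- The multi-indices `α` with `1 ≤ |α| ≤ n`. -/
abbrev ColIndex (d n : ℕ) : Type := {a : Fin d →₀ ℕ // 1 ≤ a.degree ∧ a.degree ≤ n}

instance (d n : ℕ) : Fintype (RowIndex d n) :=
  ((Finsupp.finite_of_degree_le n).subset
    (fun _ hb => Nat.le_of_lt hb : {b : Fin d →₀ ℕ | b.degree < n} ⊆ {b | b.degree ≤ n})).fintype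

instance (d n : ℕ) : Fintype (ColIndex d n) :=
  ((Finsupp.finite_of_degree_le n).subset
    (fun _ ha => ha.2 : {a : Fin d →₀ ℕ | 1 ≤ a.degree ∧ a.degree ≤ n} ⊆ {a | a.degree ≤ n})).fintype

/-! ## The Jacobian matrix of order `n` of a convergent power series -/

/-- The divided derivative `∂^c p / c!`, coefficientwise: the monomial `x^e` is mapped to
`∏ i, (e i).choose (c i) • x^(e - c)`. -/
def dividedDeriv {d : ℕ} (c : Fin d →₀ ℕ) (p : MvPowerSeries (Fin d) ℂ) :
    MvPowerSeries (Fin d) ℂ :=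
  fun a => ((∏ i, (a i + c i).choose (c i) : ℕ) : ℂ) * MvPowerSeries.coeff (a + c) p

theorem IsConvergent.dividedDeriv {d : ℕ} (c : Fin d →₀ ℕ) {p : MvPowerSeries (Fin d) ℂ}
    (hp : IsConvergent p) : IsConvergent (dividedDeriv c p) := by
  obtain ⟨r, hr, hp⟩ := hp
  refine ⟨r / 2, by positivity, ?_⟩
  have h := (hp.comp_injective (add_left_injective c)).mul_left (2 ^ c.degree * (r ^ c.degree)⁻¹)
  refine h.of_nonneg_of_le (fun a => by positivity) (fun a => ?_)
  have h1 : MvPowerSeries.coeff a (HigherNash.dividedDeriv c p) =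
    ((∏ i, (a i + c i).choose (c i) : ℕ) : ℂ) * MvPowerSeries.coeff (a + c) p := rfl
  have h2 : (∏ i, (a i + c i).choose (c i)) ≤ 2 ^ (a.degree + c.degree) := by
    calc (∏ i, (a i + c i).choose (c i)) ≤ ∏ i, 2 ^ (a i + c i) :=
          Finset.prod_le_prod' fun i _ => Nat.choose_le_two_pow _ _
      _ = 2 ^ (a.degree + c.degree) := by
          rw [Finset.prod_pow_eq_pow_sum, Finset.sum_add_distrib, Finsupp.degree_eq_sum,
            Finsupp.degree_eq_sum]
  have h3 : ((∏ i, (a i + c i).choose (c i) : ℕ) : ℝ) ≤ 2 ^ (a.degree + c.degree) := by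
    exact_mod_cast h2
  rw [h1, norm_mul, Complex.norm_natCast]
  simp only [Function.comp_apply, map_add]
  calc ((∏ i, (a i + c i).choose (c i) : ℕ) : ℝ) * ‖MvPowerSeries.coeff (a + c) p‖ *
        (r / 2) ^ a.degree
      ≤ 2 ^ (a.degree + c.degree) * ‖MvPowerSeries.coeff (a + c) p‖ * (r / 2) ^ a.degree := by
        gcongr
    _ = 2 ^ c.degree * (r ^ c.degree)⁻¹ *
        (‖MvPowerSeries.coeff (a + c) p‖ * r ^ (a.degree + c.degree)) := by
        rw [div_pow, pow_add, pow_add]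
        field_simp

/-- `Jac_n(f)`: the entry in row `β` (`|β| ≤ n - 1`) and column `α` (`1 ≤ |α| ≤ n`) is
`∂^(α - β) f / (α - β)!` if `β ≤ α` componentwise and `β ≠ α`, and `0` otherwise. -/
def jacobianMatrix {d : ℕ} (n : ℕ) (f : ConvergentSeries d) :
    Matrix (RowIndex d n) (ColIndex d n) (ConvergentSeries d) :=
  open Classical in fun b a =>
    if b.1 < a.1 then ⟨dividedDeriv (a.1 - b.1) f.1, IsConvergent.dividedDeriv _ f.2⟩ else 0

/-- The ideal of `ℂ{x}` generated by the maximal minors of `Jac_n(f)`. (A matrix with at least as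
many columns as rows; a minor is given by a choice of pairwise distinct columns.) -/
def minorIdeal {d : ℕ} (n : ℕ) (f : ConvergentSeries d) : Ideal (ConvergentSeries d) :=
  open Classical in
    Ideal.span (Set.range fun s : RowIndex d n ↪ ColIndex d n =>
      ((jacobianMatrix n f).submatrix id s).det)

/-! ## The module of differentials of order `n` of `f : 𝔸^d → 𝔸^1`, and its Fitting ideal -/

/-- The `i`-th Fitting ideal of the module generated by the finite family `v` of `N` elements:
the ideal generated by the `(N - i) × (N - i)` minors of the matrix of all relations of `v`. -/
def fittingIdeal {R M ι : Type*} [CommRing R] [AddCommGroup M] [Module R M] [Fintype ι]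
    (v : ι → M) (_hv : Submodule.span R (Set.range v) = ⊤) (i : ℕ) : Ideal R :=
  Ideal.span {m : R | ∃ (s : Fin (Fintype.card ι - i) ↪ ι)
    (c : Fin (Fintype.card ι - i) → ι → R),
    (∀ k, ∑ j, c k j • v j = 0) ∧ m = (Matrix.of fun k l => c k (s l)).det}

/-- The ring `ℂ[x₁, …, x_d]`, seen as a `ℂ[t]`-algebra through `t ↦ f`. -/
def Total {d : ℕ} (_f : MvPolynomial (Fin d) ℂ) : Type := MvPolynomial (Fin d) ℂ

variable {d : ℕ}

instance (f : MvPolynomial (Fin d) ℂ) : CommRing (Total f) :=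
  inferInstanceAs (CommRing (MvPolynomial (Fin d) ℂ))

instance (f : MvPolynomial (Fin d) ℂ) : Algebra (Polynomial ℂ) (Total f) :=
  (Polynomial.aeval f).toRingHom.toAlgebra

/-- The `i`-th coordinate function. -/
def coord (f : MvPolynomial (Fin d) ℂ) (i : Fin d) : Total f :=
  (MvPolynomial.X i : MvPolynomial (Fin d) ℂ)

/-- The kernel `I` of the multiplication map `R ⊗[ℂ[t]] R → R`, where `R = ℂ[x₁, …, x_d]`. -/
abbrev diagonalIdeal (f : MvPolynomial (Fin d) ℂ) :
    Ideal (Total f ⊗[Polynomial ℂ] Total f) :=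
  KaehlerDifferential.ideal (Polynomial ℂ) (Total f)

/-- `(R ⊗[ℂ[t]] R) / I^(n+1)`, an `R`-algebra through `ξ ↦ ξ ⊗ 1`. -/
abbrev PrincipalParts (n : ℕ) (f : MvPolynomial (Fin d) ℂ) : Type :=
  (Total f ⊗[Polynomial ℂ] Total f) ⧸ (diagonalIdeal f ^ (n + 1))

/-- `Ω_f^(n) = I / I^(n+1)`, as an `R`-submodule of `(R ⊗[ℂ[t]] R) / I^(n+1)`. -/
def higherOmega (n : ℕ) (f : MvPolynomial (Fin d) ℂ) :
    Submodule (Total f) (PrincipalParts n f) :=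
  ((diagonalIdeal f).map (Ideal.Quotient.mk (diagonalIdeal f ^ (n + 1)))).restrictScalars (Total f)

/-- `δx_i = 1 ⊗ x_i - x_i ⊗ 1`. -/
def delta (f : MvPolynomial (Fin d) ℂ) (i : Fin d) : Total f ⊗[Polynomial ℂ] Total f :=
  1 ⊗ₜ coord f i - coord f i ⊗ₜ 1

/-- `(δx)^α = ∏ i, (δx_i)^(α_i)`. -/
def deltaPow (f : MvPolynomial (Fin d) ℂ) (a : Fin d →₀ ℕ) :
    Total f ⊗[Polynomial ℂ] Total f :=
  ∏ i, delta f i ^ a i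

theorem deltaPow_mem_pow (f : MvPolynomial (Fin d) ℂ) (a : Fin d →₀ ℕ) :
    deltaPow f a ∈ diagonalIdeal f ^ a.degree := by
  rw [Finsupp.degree_eq_sum, ← Finset.prod_pow_eq_pow_sum]
  exact Ideal.prod_mem_prod fun i _ => Ideal.pow_mem_pow
    (KaehlerDifferential.one_smul_sub_smul_one_mem_ideal (Polynomial ℂ) (coord f i)) _

/-- The class of `(δx)^α` in `Ω_f^(n)`, for `1 ≤ |α| ≤ n`. -/
def deltaClass (n : ℕ) (f : MvPolynomial (Fin d) ℂ) (a : ColIndex d n) : higherOmega n f :=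
  ⟨Ideal.Quotient.mk _ (deltaPow f a.1), Ideal.mem_map_of_mem _
    (Ideal.pow_le_self (Nat.one_le_iff_ne_zero.mp a.2.1) (deltaPow_mem_pow f a.1))⟩

/-- The classes of all the powers of `δx` are the values of an evaluation map. -/
def deltaEval (n : ℕ) (f : MvPolynomial (Fin d) ℂ) :
    MvPolynomial (Fin d) (Total f) →ₐ[Total f] PrincipalParts n f :=
  MvPolynomial.aeval fun i => Ideal.Quotient.mk (diagonalIdeal f ^ (n + 1)) (delta f i)

theorem deltaEval_surjective (n : ℕ) (f : MvPolynomial (Fin d) ℂ) :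
    Function.Surjective (deltaEval n f) := by
  have hr : ∀ b : Total f, ∃ p, deltaEval n f p =
      Ideal.Quotient.mk (diagonalIdeal f ^ (n + 1)) (1 ⊗ₜ[Polynomial ℂ] b) := by
    intro b
    refine MvPolynomial.induction_on (motive := fun b : MvPolynomial (Fin d) ℂ =>
      ∃ p, deltaEval n f p = Ideal.Quotient.mk (diagonalIdeal f ^ (n + 1))
        ((1 : Total f) ⊗ₜ[Polynomial ℂ] (show Total f from b))) b ?_ ?_ ?_
    · intro c
      have hc : (show Total f from MvPolynomial.C c) =
          algebraMap (Polynomial ℂ) (Total f) (Polynomial.C c) :=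
        (Polynomial.aeval_C f c).symm
      refine ⟨MvPolynomial.C (show Total f from MvPolynomial.C c), ?_⟩
      rw [deltaEval, MvPolynomial.aeval_C, hc, ← Algebra.TensorProduct.algebraMap_apply']
      rfl
    · rintro p q ⟨p', hp⟩ ⟨q', hq⟩
      refine ⟨p' + q', ?_⟩
      rw [map_add, hp, hq, ← map_add, ← TensorProduct.tmul_add]
      rfl
    · rintro p i ⟨p', hp⟩
      refine ⟨p' * (MvPolynomial.X i + MvPolynomial.C (coord f i)), ?_⟩
      have hX : deltaEval n f (MvPolynomial.X i + MvPolynomial.C (coord f i)) =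
          Ideal.Quotient.mk (diagonalIdeal f ^ (n + 1)) (1 ⊗ₜ[Polynomial ℂ] coord f i) := by
        have h1 : deltaEval n f (MvPolynomial.C (coord f i)) =
            Ideal.Quotient.mk (diagonalIdeal f ^ (n + 1)) (coord f i ⊗ₜ[Polynomial ℂ] 1) := by
          rw [deltaEval, MvPolynomial.aeval_C]
          rfl
        rw [map_add, h1, deltaEval, MvPolynomial.aeval_X, ← map_add, delta, sub_add_cancel]
      rw [map_mul, hp, hX, ← map_mul, Algebra.TensorProduct.tmul_mul_tmul, one_mul]
      rfl
  intro z
  obtain ⟨z, rfl⟩ := Ideal.Quotient.mk_surjective z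
  induction z using TensorProduct.induction_on with
  | zero => exact ⟨0, by simp⟩
  | tmul a b =>
    obtain ⟨p, hp⟩ := hr b
    refine ⟨MvPolynomial.C a * p, ?_⟩
    have h1 : deltaEval n f (MvPolynomial.C a) =
        Ideal.Quotient.mk (diagonalIdeal f ^ (n + 1)) (a ⊗ₜ[Polynomial ℂ] 1) := by
      rw [deltaEval, MvPolynomial.aeval_C]
      rfl
    rw [map_mul, h1, hp, ← map_mul, Algebra.TensorProduct.tmul_mul_tmul, one_mul, mul_one]
  | add x y hx hy =>
    obtain ⟨p, hp⟩ := hx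
    obtain ⟨q, hq⟩ := hy
    exact ⟨p + q, by rw [map_add, hp, hq, map_add]⟩

theorem deltaEval_apply (n : ℕ) (f : MvPolynomial (Fin d) ℂ)
    (p : MvPolynomial (Fin d) (Total f)) :
    deltaEval n f p = ∑ a ∈ p.support, p.coeff a •
      Ideal.Quotient.mk (diagonalIdeal f ^ (n + 1)) (deltaPow f a) := by
  rw [deltaEval, MvPolynomial.aeval_def, MvPolynomial.eval₂_eq']
  refine Finset.sum_congr rfl fun a _ => ?_
  rw [Algebra.smul_def, deltaPow, map_prod]
  simp only [map_pow]

/-- The classes `(δx)^α`, `1 ≤ |α| ≤ n`, generate `Ω_f^(n)`. -/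
theorem span_deltaClass (n : ℕ) (f : MvPolynomial (Fin d) ℂ) :
    Submodule.span (Total f) (Set.range (deltaClass n f)) = ⊤ := by
  rw [eq_top_iff]
  rintro ⟨w, hw⟩ -
  obtain ⟨z, hz, rfl⟩ := (Ideal.mem_map_iff_of_surjective _ Ideal.Quotient.mk_surjective).mp hw
  obtain ⟨p, hp⟩ := deltaEval_surjective n f (Ideal.Quotient.mk _ z)
  -- the constant coefficient of `p` vanishes
  have h0 : p.coeff 0 = 0 := by
    have hle' : ∀ a ∈ diagonalIdeal f ^ (n + 1),
        (Algebra.TensorProduct.lmul' (Polynomial ℂ) (S := Total f)).toRingHom a = 0 :=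
      fun a ha => Ideal.pow_le_self n.succ_ne_zero ha
    have hq : ∀ q, Ideal.Quotient.lift (diagonalIdeal f ^ (n + 1))
        (Algebra.TensorProduct.lmul' (Polynomial ℂ) (S := Total f)).toRingHom hle'
          (deltaEval n f q) = MvPolynomial.constantCoeff q := by
      intro q
      induction q using MvPolynomial.induction_on with
      | C a =>
        rw [deltaEval, MvPolynomial.aeval_C, MvPolynomial.constantCoeff_C]
        change (Algebra.TensorProduct.lmul' (Polynomial ℂ) (S := Total f)) (a ⊗ₜ 1) = a
        simp
      | add p q hp hq => rw [map_add, map_add, map_add, hp, hq]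
      | mul_X p i hp =>
        rw [map_mul, map_mul, map_mul, hp, MvPolynomial.constantCoeff_X, mul_zero]
        have : deltaEval n f (MvPolynomial.X i) = Ideal.Quotient.mk _ (delta f i) := by
          rw [deltaEval, MvPolynomial.aeval_X]
        rw [this, Ideal.Quotient.lift_mk]
        have h2 : (Algebra.TensorProduct.lmul' (Polynomial ℂ) (S := Total f)).toRingHom
            (delta f i) = 0 :=
          KaehlerDifferential.one_smul_sub_smul_one_mem_ideal (Polynomial ℂ) (coord f i)
        rw [h2, mul_zero]
    have h1 := hq p
    rw [hp, Ideal.Quotient.lift_mk] at h1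
    exact h1.symm.trans hz
  have hsum : (⟨Ideal.Quotient.mk _ z, hw⟩ : higherOmega n f) =
      ∑ a ∈ p.support, if ha : 1 ≤ a.degree ∧ a.degree ≤ n then
        p.coeff a • deltaClass n f ⟨a, ha⟩ else 0 := by
    apply Subtype.ext
    rw [Submodule.coe_sum]
    change Ideal.Quotient.mk _ z = _
    rw [← hp, deltaEval_apply]
    refine Finset.sum_congr rfl fun a ha => ?_
    split_ifs with h
    · rfl
    · rw [not_and_or, not_le, not_le, Nat.lt_one_iff, Finsupp.degree_eq_zero_iff] at h
      rcases h with h | h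
      · rw [h, h0, zero_smul]
        rfl
      · have : Ideal.Quotient.mk (diagonalIdeal f ^ (n + 1)) (deltaPow f a) = 0 :=
          Ideal.Quotient.eq_zero_iff_mem.mpr (Ideal.pow_le_pow_right h (deltaPow_mem_pow f a))
        rw [this, smul_zero]
        rfl
  rw [hsum]
  refine Submodule.sum_mem _ fun a _ => ?_
  split_ifs with h
  · exact Submodule.smul_mem _ _ (Submodule.subset_span ⟨_, rfl⟩)
  · exact Submodule.zero_mem _

/-- The `n`-th Jacobian ideal `J_n(f)` of a polynomial `f`: the `r`-th Fitting ideal of `Ω_f^(n)`,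
where `r = binom (d - 1 + n) (d - 1) - 1` is the generic rank of `Ω_f^(n)`. -/
def higherJacobianIdeal (n : ℕ) (f : MvPolynomial (Fin d) ℂ) : Ideal (MvPolynomial (Fin d) ℂ) :=
  (fittingIdeal (deltaClass n f) (span_deltaClass n f) ((d - 1 + n).choose (d - 1) - 1) :
    Ideal (Total f))

/-- The `n`-th Nash blowup local algebra `M_n(f) = ℂ{x} / ⟨f, J_n(f)⟩` of a polynomial `f`. -/
abbrev NashBlowupLocalAlgebra (n : ℕ) (f : MvPolynomial (Fin d) ℂ) : Type :=
  ConvergentSeries d ⧸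
    (Ideal.span {polyToSeries d f} ⊔ (higherJacobianIdeal n f).map (polyToSeries d))

/-- The same algebra with `J_n(f)` described as the ideal of `ℂ{x}` generated by the maximal minors
of the matrix `Jac_n(f)`. -/
abbrev NashBlowupLocalAlgebraOfMinors (n : ℕ) (f : MvPolynomial (Fin d) ℂ) : Type :=
  ConvergentSeries d ⧸ (Ideal.span {polyToSeries d f} ⊔ minorIdeal n (polyToSeries d f))

end HigherNash

end

/-!
Write `S = ℂ{x}` and `A = S[δ] / (δ)^(n+1)`. The truncated Taylor expansion `T h = h(x + δ)` is a
ring homomorphism `S → A`, and the rows of `Jac_n(f)` are the coefficients of the multiples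
`δ^β (T f - f)`, `|β| < n`. Since `T f - f` has no constant term, these rows generate the ideal
of `A` spanned by `T f - f`. Hence the ideal of maximal minors of `Jac_n(f)` is generated by the
determinants `det (ω_j (p_i (T f - f)))` for elements `p_i` of `A` and functionals `ω_j`
(`multipleMinorIdeal_eq`). This description depends only on `T f - f` and on the `S`-algebra `A`,
which gives the invariance of the ideal generated by `f` and the maximal minors:

* `T (u f) - u f = T u (T f - f) + f (T u - u)`, so modulo `f` a unit `u` changes nothing
  (`nashIdeal_unit_mul`).
* An automorphism `φ` of `S` extends to an automorphism of `A` that maps `δ_i` to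
  `T (φ x_i) - φ x_i`, and this automorphism maps `T f - f` to `T (φ f) - φ f`
  (`jetLift_taylorDiff`). The latter holds for `f = x_i` by construction and for all `f` because two
  homomorphisms `S → A` that agree on the constants and on the coordinates are equal when they map
  the coordinates to elements without constant term (`ringHom_ext_of_seriesX`). That `φ` has this
  property comes from the invertibility of `x_i - c` for `c ≠ 0`.

For the Fitting ideal, with `R = ℂ[x]`, the algebra `(R ⊗[ℂ[t]] R) / I^(n+1)` is the quotient of
`R[δ] / (δ)^(n+1)` by `f(x + δ) - f(x)` (`jetToParts_eq_zero_iff`), so the rows of `Jac_n(f)`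
generate the relations between the classes `(δx)^α`. The Fitting ideal in question consists of the
minors whose size is the number of these rows, so it is the ideal of maximal minors of `Jac_n(f)`
(`map_higherJacobianIdeal`), and the two algebras of the theorem have the same defining ideal.
-/

noncomputable section

namespace HigherNash

/-! ### Ideals of maximal minors -/

/-- The ideal generated by the maximal minors of a matrix with at least as many columns as rows. -/
def maximalMinorIdeal {K ι κ : Type*} [CommRing K] [Fintype ι] [DecidableEq ι]
    (M : Matrix ι κ K) : Ideal K :=
  Ideal.span (Set.range fun s : ι ↪ κ => (M.submatrix id s).det)

/-- A weak form of the Cauchy–Binet formula, obtained by expanding the determinant of `M * N` by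
multilinearity in the columns. -/
theorem det_mul_mem_maximalMinorIdeal {K ι κ : Type*} [CommRing K] [Fintype ι] [DecidableEq ι]
    [Fintype κ] (M : Matrix ι κ K) (N : Matrix κ ι K) :
    (M * N).det ∈ maximalMinorIdeal M := by
  have h : (M * N).det = ∑ p : ι → κ, (∏ i, N (p i) i) * (M.submatrix id p).det := by
    rw [← Matrix.det_transpose]
    have h1 : (M * N).transpose = fun i => ∑ j, N j i • M.transpose j := by
      ext i k
      simp [Matrix.mul_apply, Finset.sum_apply, mul_comm]
    have h2 := (Matrix.detRowAlternating (n := ι) (R := K)).toMultilinearMap.map_sum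
      (fun i j => N j i • M.transpose j)
    rw [h1]
    refine h2.trans (Finset.sum_congr rfl fun p _ => ?_)
    rw [MultilinearMap.map_smul_univ, smul_eq_mul, ← Matrix.det_transpose (M.submatrix id p)]
    rfl
  rw [h]
  refine Ideal.sum_mem _ fun p _ => Ideal.mul_mem_left _ _ ?_
  by_cases hp : Function.Injective p
  · exact Ideal.subset_span ⟨⟨p, hp⟩, rfl⟩
  · simp only [Function.Injective, not_forall] at hp
    obtain ⟨i, j, hij, hne⟩ := hp
    rw [Matrix.det_zero_of_column_eq hne fun k => by simp [hij]]
    exact Ideal.zero_mem _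

theorem det_mul_mul_mem_maximalMinorIdeal {K ι κ : Type*} [CommRing K] [Fintype ι]
    [DecidableEq ι] [Fintype κ] (P : Matrix ι ι K) (M : Matrix ι κ K) (N : Matrix κ ι K) :
    (P * (M * N)).det ∈ maximalMinorIdeal M := by
  rw [Matrix.det_mul]
  exact Ideal.mul_mem_left _ _ (det_mul_mem_maximalMinorIdeal M N)

theorem map_maximalMinorIdeal {K K' ι κ : Type*} [CommRing K] [CommRing K'] [Fintype ι]
    [DecidableEq ι] (φ : K →+* K') (M : Matrix ι κ K) :
    (maximalMinorIdeal M).map φ = maximalMinorIdeal (M.map φ) := by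
  rw [maximalMinorIdeal, maximalMinorIdeal, Ideal.map_span, ← Set.range_comp]
  congr 2
  ext s
  simp only [Function.comp_apply, RingHom.map_det]
  rfl

theorem map_mem_pow_of_span_eq {A B : Type*} [CommRing A] [CommRing B] (ψ : A →+* B) {I : Ideal A}
    {J : Ideal B} {s : Set A} (hs : Ideal.span s = I) (h : ∀ a ∈ s, ψ a ∈ J) (k : ℕ) {a : A}
    (ha : a ∈ I ^ k) : ψ a ∈ J ^ k := by
  have h1 : I.map ψ ≤ J := by
    rw [Ideal.map_le_iff_le_comap, ← hs]
    exact Ideal.span_le.mpr h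
  have h2 := Ideal.mem_map_of_mem ψ ha
  rw [Ideal.map_pow] at h2
  exact Ideal.pow_right_mono h1 k h2

theorem map_quotientMk_self_pow {A : Type*} [CommRing A] (I : Ideal A) (k : ℕ) :
    (I.map (Ideal.Quotient.mk (I ^ k))) ^ k = ⊥ := by
  rw [← Ideal.map_pow, Ideal.map_quotient_self]

theorem map_map_quotientMk_self_pow {A : Type*} [CommRing A] (I : Ideal A) (k : ℕ)
    (J : Ideal (A ⧸ I ^ k)) :
    ((I.map (Ideal.Quotient.mk (I ^ k))).map (Ideal.Quotient.mk J)) ^ k = ⊥ := by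
  rw [← Ideal.map_pow, map_quotientMk_self_pow, Ideal.map_bot]

/-! ### Truncated polynomial rings -/

/-- The ring `K[δ₁, …, δ_d] / (δ)^(n+1)`. -/
abbrev JetRing (d n : ℕ) (K : Type*) [CommRing K] : Type _ :=
  MvPolynomial (Fin d) K ⧸ MvPolynomial.idealOfVars (Fin d) K ^ (n + 1)

section JetRing

variable {d n : ℕ} {K : Type*} [CommRing K]

/-- The coefficient of `δ^a` of a truncated polynomial, for `|a| ≤ n`. -/
def jetCoeff (a : Fin d →₀ ℕ) (ha : a.degree ≤ n) : JetRing d n K →ₗ[K] K :=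
  (Submodule.liftQ ((MvPolynomial.idealOfVars (Fin d) K ^ (n + 1)).restrictScalars K)
    (MvPolynomial.lcoeff K a) fun p hp =>
      (MvPolynomial.mem_pow_idealOfVars_iff' _ p).mp hp a (Nat.lt_succ_of_le ha)) ∘ₗ
  (Submodule.Quotient.restrictScalarsEquiv K _).symm.toLinearMap

@[simp]
theorem jetCoeff_mk (a : Fin d →₀ ℕ) (ha : a.degree ≤ n) (p : MvPolynomial (Fin d) K) :
    jetCoeff a ha (Ideal.Quotient.mk (MvPolynomial.idealOfVars (Fin d) K ^ (n + 1)) p) =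
      p.coeff a := rfl

theorem jetRing_smul_def (c : K) (x : JetRing d n K) : c • x = algebraMap K _ c * x :=
  Algebra.smul_def c x

theorem jetRing_ext {x y : JetRing d n K} (h : ∀ a ha, jetCoeff a ha x = jetCoeff a ha y) :
    x = y := by
  obtain ⟨p, rfl⟩ := Ideal.Quotient.mk_surjective x
  obtain ⟨q, rfl⟩ := Ideal.Quotient.mk_surjective y
  rw [Ideal.Quotient.eq, MvPolynomial.mem_pow_idealOfVars_iff']
  intro a ha
  rw [MvPolynomial.coeff_sub, sub_eq_zero]
  exact h a (Nat.lt_succ_iff.mp ha)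

variable (n K) in
/-- The class of the monomial `δ^a`. -/
def jetMonomial (a : Fin d →₀ ℕ) : JetRing d n K :=
  Ideal.Quotient.mk _ (MvPolynomial.monomial a 1)

theorem jetCoeff_jetMonomial [DecidableEq (Fin d →₀ ℕ)] (a b : Fin d →₀ ℕ) (ha : a.degree ≤ n) :
    jetCoeff a ha (jetMonomial n K b) = if b = a then 1 else 0 := by
  rw [jetMonomial, jetCoeff_mk, MvPolynomial.coeff_monomial]
  congr

theorem mem_map_idealOfVars_of_jetCoeff_zero (y : JetRing d n K)
    (hy : jetCoeff 0 (by simp) y = 0) :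
    y ∈ (MvPolynomial.idealOfVars (Fin d) K).map
      (Ideal.Quotient.mk (MvPolynomial.idealOfVars (Fin d) K ^ (n + 1))) := by
  obtain ⟨p, rfl⟩ := Ideal.Quotient.mk_surjective y
  refine Ideal.mem_map_of_mem _ ?_
  rw [← pow_one (MvPolynomial.idealOfVars (Fin d) K), MvPolynomial.mem_pow_idealOfVars_iff']
  intro a ha
  rw [Nat.lt_one_iff, Finsupp.degree_eq_zero_iff] at ha
  rw [ha]
  exact hy

variable (n K) in
/-- The class of the variable `δ_i`. -/
def jetX (i : Fin d) : JetRing d n K := Ideal.Quotient.mk _ (MvPolynomial.X i)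

theorem jetRing_ringHom_ext {L : Type*} [CommRing L] {α β : JetRing d n K →+* L}
    (hC : ∀ c : K, α (algebraMap K _ c) = β (algebraMap K _ c))
    (hX : ∀ i, α (jetX n K i) = β (jetX n K i)) : α = β :=
  Ideal.Quotient.ringHom_ext (MvPolynomial.ringHom_ext hC hX)

section Eval

variable {L : Type*} [CommRing L]

theorem eval₂Hom_eq_zero_of_mem_pow (φ : K →+* L) (y : Fin d → JetRing d n L)
    (hy : ∀ i, jetCoeff 0 (by simp) (y i) = 0) (p : MvPolynomial (Fin d) K)
    (hp : p ∈ MvPolynomial.idealOfVars (Fin d) K ^ (n + 1)) :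
    MvPolynomial.eval₂Hom ((algebraMap L (JetRing d n L)).comp φ) y p = 0 := by
  have h1 : ∀ a ∈ Set.range (MvPolynomial.X : Fin d → MvPolynomial (Fin d) K),
      MvPolynomial.eval₂Hom ((algebraMap L (JetRing d n L)).comp φ) y a ∈
        (MvPolynomial.idealOfVars (Fin d) L).map
          (Ideal.Quotient.mk (MvPolynomial.idealOfVars (Fin d) L ^ (n + 1))) := by
    rintro _ ⟨i, rfl⟩
    change MvPolynomial.eval₂Hom _ y (MvPolynomial.X i) ∈ _
    rw [MvPolynomial.coe_eval₂Hom, MvPolynomial.eval₂_X]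
    exact mem_map_idealOfVars_of_jetCoeff_zero _ (hy i)
  have h2 := map_mem_pow_of_span_eq _ rfl h1 (n + 1) hp
  rwa [map_quotientMk_self_pow, Ideal.mem_bot] at h2

/-- The homomorphism of truncated polynomial rings that extends a homomorphism `φ` of coefficient
rings and maps the variables to given elements without constant term. -/
def jetEval (φ : K →+* L) (y : Fin d → JetRing d n L)
    (hy : ∀ i, jetCoeff 0 (by simp) (y i) = 0) : JetRing d n K →+* JetRing d n L :=
  Ideal.Quotient.lift _ (MvPolynomial.eval₂Hom ((algebraMap L (JetRing d n L)).comp φ) y)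
    (eval₂Hom_eq_zero_of_mem_pow φ y hy)

theorem jetEval_algebraMap (φ : K →+* L) (y : Fin d → JetRing d n L)
    (hy : ∀ i, jetCoeff 0 (by simp) (y i) = 0) (c : K) :
    jetEval φ y hy (algebraMap K _ c) = algebraMap L _ (φ c) :=
  MvPolynomial.eval₂_C _ _ c

theorem jetEval_jetX (φ : K →+* L) (y : Fin d → JetRing d n L)
    (hy : ∀ i, jetCoeff 0 (by simp) (y i) = 0) (i : Fin d) :
    jetEval φ y hy (jetX n K i) = y i :=
  MvPolynomial.eval₂_X _ _ i

end Eval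

open Classical in
/-- The matrix of the multiples `δ^b F`, `|b| < n`, in the family of the monomials `δ^a`,
`1 ≤ |a| ≤ n`, for a truncated polynomial `F` without constant term. -/
def jetMatrix (F : JetRing d n K) : Matrix (RowIndex d n) (ColIndex d n) K :=
  fun b a => if b.1 < a.1 then
    jetCoeff (a.1 - b.1) ((Finsupp.degree_mono tsub_le_self).trans a.2.2) F else 0

/-- The multiples of `F` are the combinations of the rows of `jetMatrix F`. Multiples of `δ^b F` with
`|b| = n` vanish because `F` has no constant term, so that the rows with `|b| < n` suffice. -/
theorem jetCoeff_mul_of_constant_eq_zero (p F : JetRing d n K)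
    (hF : jetCoeff 0 (by simp) F = 0) (a : ColIndex d n) :
    jetCoeff a.1 a.2.2 (p * F) =
      ∑ b : RowIndex d n, jetCoeff b.1 b.2.le p * jetMatrix F b a := by
  classical
  obtain ⟨p, rfl⟩ := Ideal.Quotient.mk_surjective p
  obtain ⟨F, rfl⟩ := Ideal.Quotient.mk_surjective F
  rw [jetCoeff_mk] at hF
  simp only [jetMatrix, ← map_mul, jetCoeff_mk, MvPolynomial.coeff_mul, mul_ite, mul_zero]
  rw [← Finset.sum_filter]
  symm
  refine Finset.sum_of_injOn (fun b : RowIndex d n => (b.1, a.1 - b.1)) ?_ ?_ ?_ ?_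
  · intro b _ c _ h
    exact Subtype.ext (congrArg Prod.fst h)
  · intro b hb
    simp only [Finset.coe_filter, Finset.mem_univ, true_and, Set.mem_ofPred_eq] at hb
    simpa using add_tsub_cancel_of_le hb.le
  · rintro ⟨b, c⟩ hbc hn
    rw [Finset.HasAntidiagonal.mem_antidiagonal] at hbc
    simp only at hbc
    by_cases hc : c = 0
    · simp [hc, hF]
    · exfalso
      apply hn
      have hlt : b < a.1 := by
        rw [← hbc]
        exact lt_add_of_pos_right _ (pos_iff_ne_zero.mpr hc)
      have hdeg : b.degree < n := by
        have h1 : a.1.degree = b.degree + c.degree := by rw [← hbc, map_add]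
        have h2 : c.degree ≠ 0 := fun h => hc ((Finsupp.degree_eq_zero_iff c).mp h)
        have := a.2.2
        omega
      refine ⟨⟨b, hdeg⟩, by simpa using hlt, ?_⟩
      simp [← hbc]
  · intros; rfl

theorem jetCoeff_zero_mul_eq (y z : JetRing d n K) :
    jetCoeff 0 (by simp) (y * z) = jetCoeff 0 (by simp) y * jetCoeff 0 (by simp) z := by
  obtain ⟨p, rfl⟩ := Ideal.Quotient.mk_surjective y
  obtain ⟨q, rfl⟩ := Ideal.Quotient.mk_surjective z
  rw [← map_mul, jetCoeff_mk, jetCoeff_mk, jetCoeff_mk]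
  exact map_mul MvPolynomial.constantCoeff p q

theorem jetCoeff_zero_mul (p F : JetRing d n K) (hF : jetCoeff 0 (by simp) F = 0) :
    jetCoeff 0 (by simp) (p * F) = 0 := by
  rw [jetCoeff_zero_mul_eq, hF, mul_zero]

theorem eq_sum_jetMonomial (x : JetRing d n K) (hx : jetCoeff 0 (by simp) x = 0) :
    x = ∑ a : ColIndex d n, jetCoeff a.1 a.2.2 x • jetMonomial n K a.1 := by
  classical
  refine jetRing_ext fun a ha => ?_
  rw [map_sum]
  simp only [map_smul, jetCoeff_jetMonomial, smul_eq_mul, mul_ite, mul_one, mul_zero]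
  by_cases h0 : a = 0
  · subst h0
    rw [hx, Finset.sum_eq_zero]
    intro c _
    rw [if_neg]
    intro h
    have := c.2.1
    simp [h] at this
  · have hpos : 1 ≤ a.degree :=
      Nat.one_le_iff_ne_zero.mpr fun h => h0 ((Finsupp.degree_eq_zero_iff a).mp h)
    rw [Finset.sum_eq_single ⟨a, hpos, ha⟩]
    · simp
    · intro c _ hc
      rw [if_neg]
      exact fun h => hc (Subtype.ext h)
    · simp

open Classical in
/-- The ideal generated by the determinants of the values of linear functionals on multiples of `F`.
For `F` without constant term this is the ideal of maximal minors of `jetMatrix F`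
(`multipleMinorIdeal_eq`); the description does not refer to the variables `δ`, apart from the size
of the determinants. -/
def multipleMinorIdeal (F : JetRing d n K) : Ideal K :=
  Ideal.span (Set.range fun x : (RowIndex d n → JetRing d n K) ×
      (RowIndex d n → Module.Dual K (JetRing d n K)) =>
    (Matrix.of fun i j => x.2 j (x.1 i * F)).det)

open Classical in
theorem multipleMinorIdeal_eq (F : JetRing d n K) (hF : jetCoeff 0 (by simp) F = 0) :
    multipleMinorIdeal F = maximalMinorIdeal (jetMatrix F) := by
  apply le_antisymm
  · rw [multipleMinorIdeal, Ideal.span_le]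
    rintro _ ⟨⟨p, ω⟩, rfl⟩
    -- expand the multiples in the multiples `δ^b F`, and the functionals in the coefficients
    have h : (Matrix.of fun i j => ω j (p i * F)) =
        (Matrix.of fun i b => jetCoeff b.1 b.2.le (p i)) * (jetMatrix F *
          (Matrix.of fun (a : ColIndex d n) j => ω j (jetMonomial n K a.1))) := by
      ext i j
      rw [← Matrix.mul_assoc, Matrix.mul_apply, Matrix.of_apply,
        eq_sum_jetMonomial _ (jetCoeff_zero_mul (p i) F hF), map_sum]
      refine Finset.sum_congr rfl fun a _ => ?_
      rw [map_smul, jetCoeff_mul_of_constant_eq_zero _ _ hF, Matrix.mul_apply, smul_eq_mul]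
      rfl
    simp only [h]
    exact det_mul_mul_mem_maximalMinorIdeal _ _ _
  · rw [maximalMinorIdeal, Ideal.span_le]
    rintro _ ⟨s, rfl⟩
    refine Ideal.subset_span ⟨⟨fun b => jetMonomial n K b.1,
      fun b => jetCoeff (s b).1 (s b).2.2⟩, ?_⟩
    refine congrArg Matrix.det (Matrix.ext fun i j => ?_)
    simp only [Matrix.of_apply, Matrix.submatrix_apply, id]
    rw [jetCoeff_mul_of_constant_eq_zero _ _ hF, Finset.sum_eq_single i]
    · simp [jetCoeff_jetMonomial]
    · intro b _ hb
      rw [jetCoeff_jetMonomial, if_neg fun h => hb (Subtype.ext h.symm), zero_mul]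
    · simp

/-- The ideal `multipleMinorIdeal` is transported by semilinear ring isomorphisms. -/
theorem map_multipleMinorIdeal_le (φ : K ≃+* K) (Φ : JetRing d n K ≃+* JetRing d n K)
    (hΦ : ∀ (c : K) x, Φ (c • x) = φ c • Φ x) (F : JetRing d n K) :
    (multipleMinorIdeal F).map (φ : K →+* K) ≤ multipleMinorIdeal (Φ F) := by
  classical
  rw [multipleMinorIdeal, Ideal.map_span, Ideal.span_le]
  rintro _ ⟨_, ⟨⟨p, ω⟩, rfl⟩, rfl⟩
  have hΦ' : ∀ (c : K) x, Φ.symm (c • x) = φ.symm c • Φ.symm x := fun c x => by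
    apply Φ.injective
    rw [hΦ]
    simp
  refine Ideal.subset_span ⟨⟨fun i => Φ (p i), fun j =>
    { toFun := fun x => φ (ω j (Φ.symm x))
      map_add' := fun x y => by simp
      map_smul' := fun c x => by simp [hΦ'] }⟩, ?_⟩
  rw [RingHom.map_det]
  refine congrArg Matrix.det (Matrix.ext fun i j => ?_)
  simp only [Matrix.of_apply, LinearMap.coe_mk, AddHom.coe_mk, RingHom.mapMatrix_apply,
    Matrix.map_apply, ← map_mul, RingEquiv.symm_apply_apply]
  rfl

/-- An element that is a multiple of `F` modulo `J` contributes, modulo `J`, no more than `F` to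
`multipleMinorIdeal`. -/
theorem multipleMinorIdeal_mul_add_smul_le (J : Ideal K) (U F G : JetRing d n K) (c : K)
    (hc : c ∈ J) : multipleMinorIdeal (U * F + c • G) ≤ J ⊔ multipleMinorIdeal F := by
  classical
  rw [multipleMinorIdeal, Ideal.span_le]
  rintro _ ⟨⟨p, ω⟩, rfl⟩
  have h : (Matrix.of fun i j => ω j (p i * (U * F + c • G))).det -
      (Matrix.of fun i j => ω j (p i * U * F)).det ∈ J := by
    rw [← Ideal.Quotient.eq, RingHom.map_det, RingHom.map_det]
    refine congrArg Matrix.det (Matrix.ext fun i j => ?_)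
    simp only [RingHom.mapMatrix_apply, Matrix.map_apply, Matrix.of_apply]
    rw [Ideal.Quotient.eq, mul_add, map_add, ← mul_assoc, add_sub_cancel_left, mul_smul_comm,
      map_smul]
    exact Ideal.mul_mem_right _ _ hc
  have h2 : (Matrix.of fun i j => ω j (p i * U * F)).det ∈ multipleMinorIdeal F :=
    Ideal.subset_span ⟨⟨fun i => p i * U, ω⟩, rfl⟩
  have := add_mem (Ideal.mem_sup_left (T := multipleMinorIdeal F) h)
    (Ideal.mem_sup_right (S := J) h2)
  simpa using this

end JetRing

/-! ### Taylor expansion of convergent power series -/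

/-- The Vandermonde identity for multi-indices. -/
theorem sum_antidiagonal_prod_choose {d : ℕ} (u v c : Fin d →₀ ℕ) :
    ∑ x ∈ Finset.HasAntidiagonal.antidiagonal c,
      (∏ i, (u i).choose (x.1 i)) * (∏ i, (v i).choose (x.2 i)) =
      ∏ i, (u i + v i).choose (c i) := by
  classical
  simp only [Nat.add_choose_eq, Finset.prod_univ_sum, ← Finset.prod_mul_distrib]
  refine Finset.sum_bij' (fun x _ i => (x.1 i, x.2 i))
    (fun p _ => (Finsupp.equivFunOnFinite.symm fun i => (p i).1,
      Finsupp.equivFunOnFinite.symm fun i => (p i).2)) ?_ ?_ ?_ ?_ ?_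
  · rintro x hx
    rw [Finset.HasAntidiagonal.mem_antidiagonal] at hx
    simp [← hx]
  · intro p hp
    rw [Finset.HasAntidiagonal.mem_antidiagonal]
    ext i
    simpa using (Fintype.mem_piFinset.mp hp i)
  · intro x _
    ext <;> simp
  · intro p _
    simp
  · intro x _
    rfl

theorem coeff_dividedDeriv {d : ℕ} (c a : Fin d →₀ ℕ) (p : MvPowerSeries (Fin d) ℂ) :
    MvPowerSeries.coeff a (dividedDeriv c p) =
      ((∏ i, (a i + c i).choose (c i) : ℕ) : ℂ) * MvPowerSeries.coeff (a + c) p := rfl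

/-- The Leibniz rule for divided derivatives. On monomials it is the Vandermonde identity. -/
theorem dividedDeriv_mul {d : ℕ} (c : Fin d →₀ ℕ) (p q : MvPowerSeries (Fin d) ℂ) :
    dividedDeriv c (p * q) = ∑ x ∈ Finset.HasAntidiagonal.antidiagonal c,
      dividedDeriv x.1 p * dividedDeriv x.2 q := by
  classical
  ext a
  have hR : ∀ x ∈ Finset.HasAntidiagonal.antidiagonal c,
      MvPowerSeries.coeff a (dividedDeriv x.1 p * dividedDeriv x.2 q) =
      ∑ y ∈ Finset.HasAntidiagonal.antidiagonal (a + c),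
        (((∏ i, (y.1 i).choose (x.1 i)) * (∏ i, (y.2 i).choose (x.2 i)) : ℕ) : ℂ) *
          (MvPowerSeries.coeff y.1 p * MvPowerSeries.coeff y.2 q) := by
    rintro ⟨c1, c2⟩ hx
    rw [Finset.HasAntidiagonal.mem_antidiagonal] at hx
    simp only at hx
    rw [MvPowerSeries.coeff_mul]
    -- the terms outside the image of the shift by `(c1, c2)` carry a vanishing binomial coefficient
    refine Finset.sum_of_injOn (fun y => (y.1 + c1, y.2 + c2)) ?_ ?_ ?_ ?_
    · intro y _ z _ h
      simp only [Prod.mk.injEq, add_left_inj] at h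
      exact Prod.ext h.1 h.2
    · intro y hy
      simp only [Finset.mem_coe, Finset.HasAntidiagonal.mem_antidiagonal] at hy ⊢
      rw [← hx, ← hy]
      abel
    · rintro ⟨u, v⟩ hy hn
      rw [Finset.HasAntidiagonal.mem_antidiagonal] at hy
      simp only at hy
      by_cases h1 : c1 ≤ u
      · by_cases h2 : c2 ≤ v
        · exfalso
          obtain ⟨u, rfl⟩ := exists_add_of_le h1
          obtain ⟨v, rfl⟩ := exists_add_of_le h2
          refine hn ⟨(u, v), ?_, by simp [add_comm]⟩
          simp only [Finset.mem_coe, Finset.HasAntidiagonal.mem_antidiagonal]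
          rw [← hx] at hy
          apply add_right_cancel (b := c1 + c2)
          rw [← hy]
          abel
        · rw [Finsupp.le_def, not_forall] at h2
          obtain ⟨i, hi⟩ := h2
          rw [Finset.prod_eq_zero (i := i) (s := Finset.univ) (f := fun i => (v i).choose (c2 i))
            (Finset.mem_univ i) (Nat.choose_eq_zero_of_lt (not_le.mp hi))]
          simp
      · rw [Finsupp.le_def, not_forall] at h1
        obtain ⟨i, hi⟩ := h1
        rw [Finset.prod_eq_zero (i := i) (s := Finset.univ) (f := fun i => (u i).choose (c1 i))
          (Finset.mem_univ i) (Nat.choose_eq_zero_of_lt (not_le.mp hi))]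
        simp
    · intro y _
      simp only [coeff_dividedDeriv, Finsupp.add_apply]
      push_cast
      ring
  rw [map_sum, Finset.sum_congr rfl hR, Finset.sum_comm, coeff_dividedDeriv,
    MvPowerSeries.coeff_mul, Finset.mul_sum]
  refine Finset.sum_congr rfl fun y hy => ?_
  rw [Finset.HasAntidiagonal.mem_antidiagonal] at hy
  rw [← Finset.sum_mul, ← Nat.cast_sum, sum_antidiagonal_prod_choose]
  have h : ∀ i, a i + c i = y.1 i + y.2 i := fun i => by
    rw [← Finsupp.add_apply, ← hy, Finsupp.add_apply]
  simp only [h]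

theorem dividedDeriv_add {d : ℕ} (c : Fin d →₀ ℕ) (p q : MvPowerSeries (Fin d) ℂ) :
    dividedDeriv c (p + q) = dividedDeriv c p + dividedDeriv c q := by
  ext a
  simp only [coeff_dividedDeriv, map_add, mul_add]

theorem dividedDeriv_zero_left {d : ℕ} (p : MvPowerSeries (Fin d) ℂ) :
    dividedDeriv 0 p = p := by
  ext a
  simp [coeff_dividedDeriv]

theorem dividedDeriv_C {d : ℕ} (c : Fin d →₀ ℕ) (hc : c ≠ 0) (z : ℂ) :
    dividedDeriv c (MvPowerSeries.C z : MvPowerSeries (Fin d) ℂ) = 0 := by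
  classical
  ext a
  rw [coeff_dividedDeriv, MvPowerSeries.coeff_C, if_neg, mul_zero, map_zero]
  simp [hc]

theorem dividedDeriv_single_X {d : ℕ} (i : Fin d) :
    dividedDeriv (Finsupp.single i 1) (MvPowerSeries.X i : MvPowerSeries (Fin d) ℂ) = 1 := by
  classical
  ext a
  rw [coeff_dividedDeriv, MvPowerSeries.coeff_X, MvPowerSeries.coeff_one]
  by_cases h : a = 0
  · subst h
    simp [Finsupp.single_apply]
  · simp [h]

theorem dividedDeriv_X_of_ne {d : ℕ} (i : Fin d) (c : Fin d →₀ ℕ) (h0 : c ≠ 0)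
    (h1 : c ≠ Finsupp.single i 1) :
    dividedDeriv c (MvPowerSeries.X i : MvPowerSeries (Fin d) ℂ) = 0 := by
  classical
  ext a
  rw [coeff_dividedDeriv, MvPowerSeries.coeff_X, map_zero, if_neg, mul_zero]
  intro h
  have hdeg := congrArg Finsupp.degree h
  rw [map_add, Finsupp.degree_single] at hdeg
  have hc : c.degree ≠ 0 := fun h => h0 ((Finsupp.degree_eq_zero_iff c).mp h)
  have ha : a = 0 := (Finsupp.degree_eq_zero_iff a).mp (by omega)
  rw [ha, zero_add] at h
  exact h1 h

section Taylor

variable {d : ℕ}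

/-- The divided derivative `∂^c h / c!` of a convergent power series. -/
def seriesDeriv (c : Fin d →₀ ℕ) (h : ConvergentSeries d) : ConvergentSeries d :=
  ⟨dividedDeriv c h.1, IsConvergent.dividedDeriv _ h.2⟩

theorem seriesDeriv_algebraMap (c : Fin d →₀ ℕ) (hc : c ≠ 0) (z : ℂ) :
    seriesDeriv c (algebraMap ℂ (ConvergentSeries d) z) = 0 :=
  Subtype.ext (dividedDeriv_C c hc z)

/-- The Taylor expansion `h(x + δ) = ∑ ∂^c h / c! δ^c`. -/
def taylorSeries : ConvergentSeries d →+* MvPowerSeries (Fin d) (ConvergentSeries d) where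
  toFun h := fun c => seriesDeriv c h
  map_one' := by
    classical
    ext1 c
    rw [MvPowerSeries.coeff_one]
    split_ifs with hc
    · subst hc
      exact Subtype.ext (dividedDeriv_zero_left _)
    · have := seriesDeriv_algebraMap c hc 1
      rwa [map_one] at this
  map_mul' p q := by
    ext1 c
    refine Eq.trans ?_ (MvPowerSeries.coeff_mul c _ _).symm
    apply Subtype.ext
    rw [AddSubmonoidClass.coe_finsetSum]
    exact dividedDeriv_mul c p.1 q.1
  map_zero' := by
    ext1 c
    apply Subtype.ext
    ext a
    exact mul_zero _
  map_add' p q := by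
    ext1 c
    exact Subtype.ext (dividedDeriv_add c p.1 q.1)

variable (d) in
/-- The Taylor expansion of order `n`. -/
def taylorJet (n : ℕ) : ConvergentSeries d →+* JetRing d n (ConvergentSeries d) :=
  (MvPowerSeries.truncTotalAlgHom (Fin d) (ConvergentSeries d) (n + 1)).toRingHom.comp taylorSeries

theorem jetCoeff_taylorJet {n : ℕ} (c : Fin d →₀ ℕ) (hc : c.degree ≤ n)
    (h : ConvergentSeries d) : jetCoeff c hc (taylorJet d n h) = seriesDeriv c h :=
  MvPowerSeries.coeff_truncTotal _ (Nat.lt_succ_of_le hc)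

theorem jetCoeff_algebraMap {n : ℕ} {K : Type*} [CommRing K] [DecidableEq (Fin d →₀ ℕ)]
    (a : Fin d →₀ ℕ) (ha : a.degree ≤ n) (c : K) :
    jetCoeff a ha (algebraMap K (JetRing d n K) c) = if a = 0 then c else 0 := by
  change MvPolynomial.coeff a (MvPolynomial.C c) = _
  rw [MvPolynomial.coeff_C]
  simp only [eq_comm]

theorem taylorJet_algebraMap (n : ℕ) (z : ℂ) :
    taylorJet d n (algebraMap ℂ (ConvergentSeries d) z) =
      algebraMap (ConvergentSeries d) _ (algebraMap ℂ (ConvergentSeries d) z) := by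
  classical
  refine jetRing_ext fun a ha => ?_
  rw [jetCoeff_taylorJet, jetCoeff_algebraMap]
  split_ifs with h
  · subst h
    exact Subtype.ext (dividedDeriv_zero_left _)
  · exact seriesDeriv_algebraMap a h z

variable (d) in
/-- The coordinate `x_i` as a convergent power series. -/
def seriesX (i : Fin d) : ConvergentSeries d := polyToSeries d (MvPolynomial.X i)

theorem coe_polyToSeries (f : MvPolynomial (Fin d) ℂ) :
    (polyToSeries d f : MvPowerSeries (Fin d) ℂ) = f := by
  ext a
  simp [polyToSeries]

theorem coe_seriesX (i : Fin d) : (seriesX d i : MvPowerSeries (Fin d) ℂ) = MvPowerSeries.X i := by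
  rw [seriesX, coe_polyToSeries, MvPolynomial.coe_X]

theorem taylorJet_seriesX (n : ℕ) (i : Fin d) :
    taylorJet d n (seriesX d i) =
      algebraMap _ (JetRing d n (ConvergentSeries d)) (seriesX d i) + jetX n _ i := by
  classical
  refine jetRing_ext fun a ha => ?_
  have hX : jetCoeff a ha (jetX n (ConvergentSeries d) i) =
      if Finsupp.single i 1 = a then 1 else 0 := by
    change MvPolynomial.coeff a (MvPolynomial.X i) = _
    rw [MvPolynomial.coeff_X]
  rw [jetCoeff_taylorJet, map_add, jetCoeff_algebraMap, hX]
  apply Subtype.ext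
  change dividedDeriv a (seriesX d i : MvPowerSeries (Fin d) ℂ) = _
  by_cases h0 : a = 0
  · subst h0
    rw [dividedDeriv_zero_left]
    simp
  · rw [if_neg h0, zero_add, coe_seriesX]
    split_ifs with h
    · rw [← h, dividedDeriv_single_X]
      rfl
    · rw [dividedDeriv_X_of_ne i a h0 (Ne.symm h)]
      rfl

variable (n : ℕ) in
/-- The truncated Taylor expansion of `h(x + δ) - h(x)`. -/
def taylorDiff (h : ConvergentSeries d) : JetRing d n (ConvergentSeries d) :=
  taylorJet d n h - algebraMap _ _ h

theorem jetCoeff_zero_taylorDiff (n : ℕ) (h : ConvergentSeries d) :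
    jetCoeff 0 (by simp) (taylorDiff n h) = 0 := by
  classical
  rw [taylorDiff, map_sub, jetCoeff_taylorJet, jetCoeff_algebraMap, if_pos rfl, sub_eq_zero]
  exact Subtype.ext (dividedDeriv_zero_left _)

theorem jacobianMatrix_eq_jetMatrix (n : ℕ) (f : ConvergentSeries d) :
    jacobianMatrix n f = jetMatrix (taylorDiff n f) := by
  classical
  ext1 b a
  rw [jacobianMatrix, jetMatrix]
  by_cases h : b.1 < a.1
  · rw [if_pos h, if_pos h, taylorDiff, map_sub, jetCoeff_taylorJet, jetCoeff_algebraMap, if_neg,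
      sub_zero]
    · rfl
    · exact (tsub_pos_of_lt h).ne'
  · rw [if_neg h, if_neg h]

open Classical in
theorem minorIdeal_eq (n : ℕ) (f : ConvergentSeries d) :
    minorIdeal n f = maximalMinorIdeal (jetMatrix (taylorDiff n f)) := by
  rw [minorIdeal, jacobianMatrix_eq_jetMatrix, maximalMinorIdeal]

theorem minorIdeal_eq_multipleMinorIdeal (n : ℕ) (f : ConvergentSeries d) :
    minorIdeal n f = multipleMinorIdeal (taylorDiff n f) := by
  rw [minorIdeal_eq, multipleMinorIdeal_eq _ (jetCoeff_zero_taylorDiff n f)]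

end Taylor

/-! ### Powers of the maximal ideal of the ring of convergent power series -/

section Order

variable {d : ℕ}

open Classical in
/-- The quotient by `x_i` of the part of `h` formed by the monomials in which `x_i` is the first
variable that occurs. -/
def firstVarQuotient (i : Fin d) (h : ConvergentSeries d) : ConvergentSeries d :=
  ⟨fun a => if ∀ j < i, a j = 0 then MvPowerSeries.coeff (a + Finsupp.single i 1) h.1 else 0, by
    obtain ⟨r, hr, hp⟩ := h.2
    refine ⟨r, hr, ?_⟩
    have h1 := (hp.comp_injective (add_left_injective (Finsupp.single i 1))).mul_left r⁻¹
    refine h1.of_nonneg_of_le (fun a => by positivity) (fun a => ?_)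
    have h2 : ‖MvPowerSeries.coeff a (fun a => if ∀ j < i, a j = 0 then
        MvPowerSeries.coeff (a + Finsupp.single i 1) h.1 else 0 : MvPowerSeries (Fin d) ℂ)‖ ≤
        ‖MvPowerSeries.coeff (a + Finsupp.single i 1) h.1‖ := by
      change ‖(if ∀ j < i, a j = 0 then
        MvPowerSeries.coeff (a + Finsupp.single i 1) h.1 else 0)‖ ≤ _
      split_ifs
      · exact le_rfl
      · simp
    simp only [Function.comp_apply, map_add, Finsupp.degree_single, pow_succ]
    calc _ ≤ ‖MvPowerSeries.coeff (a + Finsupp.single i 1) h.1‖ * r ^ a.degree := by gcongr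
      _ = _ := by field_simp⟩

open Classical in
theorem coeff_firstVarQuotient (i : Fin d) (h : ConvergentSeries d) (a : Fin d →₀ ℕ) :
    MvPowerSeries.coeff a (firstVarQuotient i h).1 =
      if ∀ j < i, a j = 0 then MvPowerSeries.coeff (a + Finsupp.single i 1) h.1 else 0 := rfl

theorem eq_sum_seriesX_mul_firstVarQuotient (h : ConvergentSeries d)
    (h0 : MvPowerSeries.coeff 0 h.1 = 0) :
    h = ∑ i, seriesX d i * firstVarQuotient i h := by
  classical
  apply Subtype.ext
  rw [AddSubmonoidClass.coe_finsetSum]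
  ext a
  have hi : ∀ i, MvPowerSeries.coeff a (seriesX d i * firstVarQuotient i h).1 =
      if a i ≠ 0 ∧ ∀ j < i, a j = 0 then MvPowerSeries.coeff a h.1 else 0 := by
    intro i
    rw [MulMemClass.coe_mul, coe_seriesX, MvPowerSeries.X_def, MvPowerSeries.coeff_monomial_mul,
      one_mul, coeff_firstVarQuotient]
    by_cases hai : a i = 0
    · rw [if_neg, if_neg]
      · exact fun h => h.1 hai
      · intro hle
        have := hle i
        simp [hai] at this
    · have hle : Finsupp.single i 1 ≤ a := by
        rw [Finsupp.single_le_iff]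
        exact Nat.one_le_iff_ne_zero.mpr hai
      rw [if_pos hle, tsub_add_cancel_of_le hle]
      refine if_congr ?_ rfl rfl
      simp only [ne_eq, hai, not_false_eq_true, true_and]
      refine forall₂_congr fun j hj => ?_
      simp [hj.ne']
  rw [map_sum, Finset.sum_congr rfl fun i _ => hi i]
  by_cases ha : a = 0
  · subst ha
    simp [h0]
  · have hne : (Finset.univ.filter fun i => a i ≠ 0).Nonempty := by
      obtain ⟨i, hi⟩ := Finsupp.ne_iff.mp ha
      exact ⟨i, by simpa using hi⟩
    have hm := Finset.min'_mem _ hne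
    rw [Finset.mem_filter] at hm
    rw [Finset.sum_eq_single ((Finset.univ.filter fun i => a i ≠ 0).min' hne), if_pos]
    · refine ⟨hm.2, fun j hj => ?_⟩
      by_contra hj0
      exact absurd hj (not_lt.mpr (Finset.min'_le _ _ (by simpa using hj0)))
    · intro i _ hi
      rw [if_neg]
      rintro ⟨h1, h2⟩
      rcases lt_or_gt_of_ne hi with hlt | hlt
      · exact absurd hlt (not_lt.mpr (Finset.min'_le _ _ (by simpa using h1)))
      · exact hm.2 (h2 _ hlt)
    · simp

/-- A convergent power series of order at least `k` lies in the `k`-th power of the ideal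
generated by the coordinates. -/
theorem mem_span_seriesX_pow (k : ℕ) (h : ConvergentSeries d)
    (hk : ∀ a : Fin d →₀ ℕ, a.degree < k → MvPowerSeries.coeff a h.1 = 0) :
    h ∈ Ideal.span (Set.range (seriesX d)) ^ k := by
  classical
  induction k generalizing h with
  | zero => simp
  | succ k ih =>
    rw [eq_sum_seriesX_mul_firstVarQuotient h (hk 0 (by simp)), pow_succ']
    refine Ideal.sum_mem _ fun i _ => Ideal.mul_mem_mul (Ideal.subset_span ⟨i, rfl⟩) (ih _ ?_)
    intro a ha
    rw [coeff_firstVarQuotient, hk _ (by simpa using ha), ite_self]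

open Classical in
/-- The function `x_i - c` is invertible at the origin if `c ≠ 0`; the inverse is the geometric
series. -/
theorem isUnit_seriesX_sub_algebraMap (i : Fin d) (c : ℂ) (hc : c ≠ 0) :
    IsUnit (seriesX d i - algebraMap ℂ (ConvergentSeries d) c) := by
  let w : MvPowerSeries (Fin d) ℂ :=
    fun a => if a = Finsupp.single i (a i) then -(c⁻¹) ^ (a i + 1) else 0
  have hw : ∀ a, MvPowerSeries.coeff a w =
    if a = Finsupp.single i (a i) then -(c⁻¹) ^ (a i + 1) else 0 := fun _ => rfl
  have hconv : IsConvergent w := by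
    have hc' : 0 < ‖c‖ := norm_pos_iff.mpr hc
    refine ⟨‖c‖ / 2, by positivity, ?_⟩
    have hinj : Function.Injective fun k : ℕ => Finsupp.single i k := Finsupp.single_injective i
    rw [← hinj.summable_iff]
    · refine (summable_geometric_two.mul_left ‖c‖⁻¹).congr fun k => ?_
      simp only [Function.comp_apply, hw, Finsupp.single_eq_same, if_true, norm_neg, norm_pow,
        norm_inv, Finsupp.degree_single]
      rw [pow_succ, div_pow, div_pow, one_pow, inv_pow]
      field_simp
    · intro a ha
      rw [hw, if_neg fun h => ha ⟨_, h.symm⟩, norm_zero, zero_mul]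
  refine IsUnit.of_mul_eq_one ⟨w, hconv⟩ (Subtype.ext ?_)
  change ((seriesX d i : MvPowerSeries (Fin d) ℂ) - MvPowerSeries.C c) * w = 1
  ext a
  rw [coe_seriesX, sub_mul, map_sub, MvPowerSeries.coeff_C_mul, MvPowerSeries.X_def,
    MvPowerSeries.coeff_monomial_mul, one_mul, MvPowerSeries.coeff_one, hw a]
  by_cases ha : a = Finsupp.single i (a i)
  · rw [if_pos ha]
    obtain ⟨k, hk⟩ : ∃ k, a i = k := ⟨_, rfl⟩
    rw [hk] at ha
    subst ha
    cases k with
    | zero => simp [hc]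
    | succ k =>
      rw [if_pos (by simp), ← Finsupp.single_tsub, hw]
      simp only [Nat.add_sub_cancel, Finsupp.single_eq_same, if_true, Finsupp.single_eq_zero,
        Nat.succ_ne_zero, if_false]
      rw [pow_succ c⁻¹ (k + 1), mul_neg, mul_left_comm, mul_inv_cancel₀ hc]
      simp
  · have ha0 : a ≠ 0 := by
      rintro rfl
      simp at ha
    rw [if_neg ha, if_neg ha0, mul_zero, sub_zero]
    split_ifs with hle
    · rw [hw, if_neg]
      intro h
      apply ha
      have h2 := tsub_add_cancel_of_le hle
      rw [h, ← Finsupp.single_add] at h2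
      rw [← h2]
      simp
    · rfl

/-- Automorphisms of the ring of convergent power series fix the origin: if `φ(x_i)` had the nonzero
value `c` there, then the unit `x_i - c` would be mapped to a nonunit. -/
theorem constantCoeff_algEquiv_seriesX (φ : ConvergentSeries d ≃ₐ[ℂ] ConvergentSeries d)
    (i : Fin d) : MvPowerSeries.coeff 0 (φ (seriesX d i)).1 = 0 := by
  by_contra hc
  have h := (isUnit_seriesX_sub_algebraMap i _ hc).map φ
  rw [map_sub, AlgEquiv.commutes] at h
  obtain ⟨w, hw⟩ := h.exists_right_inv
  have h2 := congrArg (fun p : ConvergentSeries d => MvPowerSeries.constantCoeff p.1) hw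
  change MvPowerSeries.constantCoeff (((φ (seriesX d i)).1 - MvPowerSeries.C
    (MvPowerSeries.coeff 0 (φ (seriesX d i)).1)) * w.1) = MvPowerSeries.constantCoeff 1 at h2
  rw [map_mul, map_sub, MvPowerSeries.constantCoeff_C,
    MvPowerSeries.coeff_zero_eq_constantCoeff_apply, sub_self, zero_mul, map_one] at h2
  exact zero_ne_one h2

/-! ### Ring homomorphisms from convergent power series to truncated polynomials -/

variable {n : ℕ}

theorem degree_fst_le_of_antidiagonal {a : Fin d →₀ ℕ} (ha : a.degree ≤ n)
    (x : {x // x ∈ Finset.HasAntidiagonal.antidiagonal a}) : x.1.1.degree ≤ n := by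
  have h := congrArg Finsupp.degree (Finset.HasAntidiagonal.mem_antidiagonal.mp x.2)
  rw [map_add] at h
  omega

theorem degree_snd_le_of_antidiagonal {a : Fin d →₀ ℕ} (ha : a.degree ≤ n)
    (x : {x // x ∈ Finset.HasAntidiagonal.antidiagonal a}) : x.1.2.degree ≤ n := by
  have h := congrArg Finsupp.degree (Finset.HasAntidiagonal.mem_antidiagonal.mp x.2)
  rw [map_add] at h
  omega

theorem jetCoeff_mul {K : Type*} [CommRing K] (a : Fin d →₀ ℕ) (ha : a.degree ≤ n)
    (y z : JetRing d n K) :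
    jetCoeff a ha (y * z) = ∑ x ∈ (Finset.HasAntidiagonal.antidiagonal a).attach,
      jetCoeff x.1.1 (degree_fst_le_of_antidiagonal ha x) y *
        jetCoeff x.1.2 (degree_snd_le_of_antidiagonal ha x) z := by
  classical
  obtain ⟨y, rfl⟩ := Ideal.Quotient.mk_surjective y
  obtain ⟨z, rfl⟩ := Ideal.Quotient.mk_surjective z
  simp only [← map_mul, jetCoeff_mk]
  rw [MvPolynomial.coeff_mul]
  exact (Finset.sum_attach _ fun x : (Fin d →₀ ℕ) × (Fin d →₀ ℕ) =>
    MvPolynomial.coeff x.1 y * MvPolynomial.coeff x.2 z).symm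

/-- Orders of vanishing in the variables `x` and `δ` together are additive. -/
theorem coeff_jetCoeff_mul_eq_zero (k l : ℕ) (y z : JetRing d n (ConvergentSeries d))
    (hy : ∀ a ha (b : Fin d →₀ ℕ), b.degree + a.degree < k →
      MvPowerSeries.coeff b (jetCoeff a ha y).1 = 0)
    (hz : ∀ a ha (b : Fin d →₀ ℕ), b.degree + a.degree < l →
      MvPowerSeries.coeff b (jetCoeff a ha z).1 = 0)
    (a : Fin d →₀ ℕ) (ha : a.degree ≤ n) (b : Fin d →₀ ℕ) (hab : b.degree + a.degree < k + l) :
    MvPowerSeries.coeff b (jetCoeff a ha (y * z)).1 = 0 := by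
  classical
  rw [jetCoeff_mul, AddSubmonoidClass.coe_finsetSum, map_sum]
  refine Finset.sum_eq_zero fun x _ => ?_
  rw [MulMemClass.coe_mul, MvPowerSeries.coeff_mul]
  refine Finset.sum_eq_zero fun v hv => ?_
  have h1 : x.1.1.degree + x.1.2.degree = a.degree := by
    rw [← map_add, Finset.HasAntidiagonal.mem_antidiagonal.mp x.2]
  have h2 : v.1.degree + v.2.degree = b.degree := by
    rw [← map_add, Finset.HasAntidiagonal.mem_antidiagonal.mp hv]
  by_cases h : v.1.degree + x.1.1.degree < k
  · rw [hy _ _ _ h, zero_mul]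
  · rw [hz _ _ v.2 (by omega), mul_zero]

variable (d n) in
/-- The ideal of the truncated polynomials in `x` and `δ` all of whose monomials have total degree
at least `k`. -/
def jetFiltration (k : ℕ) : Ideal (JetRing d n (ConvergentSeries d)) where
  carrier := {y | ∀ a ha (b : Fin d →₀ ℕ), b.degree + a.degree < k →
    MvPowerSeries.coeff b (jetCoeff a ha y).1 = 0}
  zero_mem' a ha b _ := by
    rw [map_zero]
    exact map_zero _
  add_mem' hy hz a ha b h := by
    rw [map_add, AddMemClass.coe_add, map_add, hy a ha b h, hz a ha b h, add_zero]
  smul_mem' c y hy a ha b h := by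
    rw [smul_eq_mul]
    exact coeff_jetCoeff_mul_eq_zero 0 k c y (fun _ _ _ h => absurd h (Nat.not_lt_zero _)) hy a ha b
      (by simpa using h)

theorem mem_jetFiltration {k : ℕ} {y : JetRing d n (ConvergentSeries d)} :
    y ∈ jetFiltration d n k ↔ ∀ a ha (b : Fin d →₀ ℕ), b.degree + a.degree < k →
      MvPowerSeries.coeff b (jetCoeff a ha y).1 = 0 := Iff.rfl

theorem jetFiltration_one_pow_le (k : ℕ) : jetFiltration d n 1 ^ k ≤ jetFiltration d n k := by
  induction k with
  | zero => exact fun y _ a ha b h => absurd h (Nat.not_lt_zero _)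
  | succ k ih =>
    refine (pow_succ (jetFiltration d n 1) k).le.trans (Ideal.mul_le.mpr ?_)
    exact fun y hy z hz => coeff_jetCoeff_mul_eq_zero k 1 y z (ih hy) hz

theorem eq_zero_of_forall_mem_jetFiltration (y : JetRing d n (ConvergentSeries d))
    (hy : ∀ k, y ∈ jetFiltration d n k) : y = 0 := by
  refine jetRing_ext fun a ha => Subtype.ext ?_
  rw [map_zero]
  ext b
  rw [mem_jetFiltration.mp (hy (b.degree + a.degree + 1)) a ha b (Nat.lt_succ_self _)]
  exact (map_zero _).symm

/-- A homomorphism from convergent power series to truncated polynomials is determined by its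
values on the constants and on the coordinates, provided that the coordinates are mapped to
elements without constant term. It is automatically continuous: convergent power series of high
order are mapped to elements of high total degree. -/
theorem ringHom_ext_of_seriesX (α β : ConvergentSeries d →+* JetRing d n (ConvergentSeries d))
    (hC : ∀ z : ℂ, α (algebraMap ℂ _ z) = β (algebraMap ℂ _ z))
    (hX : ∀ i, α (seriesX d i) = β (seriesX d i))
    (h0 : ∀ i, MvPowerSeries.coeff 0 (jetCoeff 0 (by simp) (α (seriesX d i))).1 = 0) :
    α = β := by
  have hpoly : α.comp (polyToSeries d).toRingHom = β.comp (polyToSeries d).toRingHom := by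
    refine MvPolynomial.ringHom_ext (fun z => ?_) hX
    change α (polyToSeries d (algebraMap ℂ _ z)) = β (polyToSeries d (algebraMap ℂ _ z))
    rw [AlgHom.commutes, hC]
  have hmem : ∀ i, α (seriesX d i) ∈ jetFiltration d n 1 := by
    intro i a ha b hab
    have ha0 : a = 0 := (Finsupp.degree_eq_zero_iff a).mp (by omega)
    have hb0 : b = 0 := (Finsupp.degree_eq_zero_iff b).mp (by omega)
    subst ha0 hb0
    exact h0 i
  have hpow : ∀ γ : ConvergentSeries d →+* JetRing d n (ConvergentSeries d),
      (∀ i, γ (seriesX d i) ∈ jetFiltration d n 1) → ∀ k,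
        (Ideal.span (Set.range (seriesX d)) ^ k).map γ ≤ jetFiltration d n k := by
    intro γ hγ k
    rw [Ideal.map_pow]
    refine (Ideal.pow_right_mono ?_ k).trans (jetFiltration_one_pow_le k)
    rw [Ideal.map_span, Ideal.span_le]
    rintro _ ⟨_, ⟨i, rfl⟩, rfl⟩
    exact hγ i
  ext1 h
  rw [← sub_eq_zero]
  refine eq_zero_of_forall_mem_jetFiltration _ fun k => ?_
  obtain ⟨p, r, hr, rfl⟩ : ∃ (p : MvPolynomial (Fin d) ℂ) (r : ConvergentSeries d),
      r ∈ Ideal.span (Set.range (seriesX d)) ^ k ∧ h = polyToSeries d p + r := by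
    refine ⟨MvPowerSeries.truncTotal k h.1, h - polyToSeries d (MvPowerSeries.truncTotal k h.1),
      mem_span_seriesX_pow k _ fun a ha => ?_, by ring⟩
    rw [AddSubgroupClass.coe_sub, coe_polyToSeries, map_sub, MvPolynomial.coeff_coe,
      MvPowerSeries.coeff_truncTotal _ ha, sub_self]
  have hp : α (polyToSeries d p) = β (polyToSeries d p) := RingHom.congr_fun hpoly p
  rw [map_add, map_add, hp, add_sub_add_left_eq_sub]
  exact sub_mem (hpow α hmem k (Ideal.mem_map_of_mem _ hr))
    (hpow β (fun i => hX i ▸ hmem i) k (Ideal.mem_map_of_mem _ hr))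

/-! ### The action of automorphisms on truncated Taylor expansions -/

/-- The endomorphism of `ℂ{x}[δ] / (δ)^(n+1)` that extends an endomorphism `φ` of `ℂ{x}` and maps
`δ_i` to the truncated Taylor expansion of `φ(x_i)(x + δ) - φ(x_i)(x)`. -/
def jetLift (n : ℕ) (φ : ConvergentSeries d →+* ConvergentSeries d) :
    JetRing d n (ConvergentSeries d) →+* JetRing d n (ConvergentSeries d) :=
  jetEval φ (fun i => taylorDiff n (φ (seriesX d i))) fun _ => jetCoeff_zero_taylorDiff _ _

theorem jetLift_algebraMap (φ : ConvergentSeries d →+* ConvergentSeries d)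
    (c : ConvergentSeries d) :
    jetLift n φ (algebraMap _ _ c) = algebraMap _ _ (φ c) :=
  jetEval_algebraMap _ _ _ c

theorem jetLift_jetX (φ : ConvergentSeries d →+* ConvergentSeries d) (i : Fin d) :
    jetLift n φ (jetX n _ i) = taylorDiff n (φ (seriesX d i)) :=
  jetEval_jetX _ _ _ i

/-- Taylor expansion commutes with automorphisms: this is the chain rule of order `n`. -/
theorem jetLift_taylorJet (φ : ConvergentSeries d ≃ₐ[ℂ] ConvergentSeries d)
    (h : ConvergentSeries d) :
    jetLift n (φ : ConvergentSeries d →+* ConvergentSeries d) (taylorJet d n h) =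
      taylorJet d n (φ h) := by
  have hX : ∀ i, jetLift n (φ : ConvergentSeries d →+* ConvergentSeries d)
      (taylorJet d n (seriesX d i)) = taylorJet d n (φ (seriesX d i)) := by
    intro i
    rw [taylorJet_seriesX, map_add, jetLift_algebraMap, jetLift_jetX, taylorDiff]
    exact add_sub_cancel _ _
  refine RingHom.congr_fun (ringHom_ext_of_seriesX
    ((jetLift n (φ : ConvergentSeries d →+* ConvergentSeries d)).comp (taylorJet d n))
    ((taylorJet d n).comp (φ : ConvergentSeries d →+* ConvergentSeries d)) ?_ hX ?_) h
  · intro z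
    simp only [RingHom.comp_apply]
    rw [taylorJet_algebraMap, jetLift_algebraMap]
    change algebraMap _ _ (φ (algebraMap ℂ _ z)) = taylorJet d n (φ (algebraMap ℂ _ z))
    rw [AlgEquiv.commutes, taylorJet_algebraMap]
  · intro i
    rw [RingHom.comp_apply, hX, jetCoeff_taylorJet]
    change MvPowerSeries.coeff 0 (dividedDeriv 0 (φ (seriesX d i)).1) = 0
    rw [dividedDeriv_zero_left]
    exact constantCoeff_algEquiv_seriesX φ i

theorem jetLift_taylorDiff (φ : ConvergentSeries d ≃ₐ[ℂ] ConvergentSeries d)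
    (h : ConvergentSeries d) :
    jetLift n (φ : ConvergentSeries d →+* ConvergentSeries d) (taylorDiff n h) =
      taylorDiff n (φ h) := by
  rw [taylorDiff, map_sub, jetLift_taylorJet, jetLift_algebraMap]
  rfl

theorem jetLift_comp_jetLift (φ ψ : ConvergentSeries d ≃ₐ[ℂ] ConvergentSeries d)
    (h : ∀ x, φ (ψ x) = x) :
    (jetLift n (φ : ConvergentSeries d →+* ConvergentSeries d)).comp
      (jetLift n (ψ : ConvergentSeries d →+* ConvergentSeries d)) = RingHom.id _ := by
  refine jetRing_ringHom_ext (fun c => ?_) fun i => ?_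
  · simp only [RingHom.comp_apply, RingHom.id_apply]
    rw [jetLift_algebraMap, jetLift_algebraMap]
    exact congrArg _ (h c)
  · simp only [RingHom.comp_apply, RingHom.id_apply]
    rw [jetLift_jetX]
    refine (jetLift_taylorDiff φ _).trans ?_
    change taylorDiff n (φ (ψ (seriesX d i))) = _
    rw [h, taylorDiff, taylorJet_seriesX, add_sub_cancel_left]

/-- The automorphism of `ℂ{x}[δ] / (δ)^(n+1)` induced by an automorphism of `ℂ{x}`. -/
def jetEquiv (n : ℕ) (φ : ConvergentSeries d ≃ₐ[ℂ] ConvergentSeries d) :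
    JetRing d n (ConvergentSeries d) ≃+* JetRing d n (ConvergentSeries d) :=
  RingEquiv.ofRingHom (jetLift n (φ : ConvergentSeries d →+* ConvergentSeries d))
    (jetLift n (φ.symm : ConvergentSeries d →+* ConvergentSeries d))
    (jetLift_comp_jetLift _ _ φ.apply_symm_apply) (jetLift_comp_jetLift _ _ φ.symm_apply_apply)

/-- An automorphism `φ` maps the ideal of `f(x + δ) - f(x)` to the one of the corresponding difference
for `φ(f)`, and thereby the ideal of minors of `f` into the one of `φ(f)`. -/
theorem map_minorIdeal_le (n : ℕ) (φ : ConvergentSeries d ≃ₐ[ℂ] ConvergentSeries d)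
    (f : ConvergentSeries d) : (minorIdeal n f).map φ ≤ minorIdeal n (φ f) := by
  rw [minorIdeal_eq_multipleMinorIdeal, minorIdeal_eq_multipleMinorIdeal]
  have h := map_multipleMinorIdeal_le φ.toRingEquiv (jetEquiv n φ) (fun c x => by
    change jetLift n _ (c • x) = φ c • jetLift n _ x
    rw [jetRing_smul_def, jetRing_smul_def, map_mul, jetLift_algebraMap]
    rfl) (taylorDiff n f)
  have h2 : jetEquiv n φ (taylorDiff n f) = taylorDiff n (φ f) := jetLift_taylorDiff φ f
  rw [h2] at h
  exact h

variable (n) in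
/-- The ideal of `ℂ{x}` generated by `f` and by the maximal minors of `Jac_n(f)`. -/
def nashIdeal (f : ConvergentSeries d) : Ideal (ConvergentSeries d) :=
  Ideal.span {f} ⊔ minorIdeal n f

theorem map_nashIdeal_le (φ : ConvergentSeries d ≃ₐ[ℂ] ConvergentSeries d)
    (f : ConvergentSeries d) : (nashIdeal n f).map φ ≤ nashIdeal n (φ f) := by
  rw [nashIdeal, nashIdeal, Ideal.map_sup, Ideal.map_span, Set.image_singleton]
  exact sup_le_sup le_rfl (map_minorIdeal_le n φ f)

theorem map_nashIdeal (φ : ConvergentSeries d ≃ₐ[ℂ] ConvergentSeries d)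
    (f : ConvergentSeries d) : (nashIdeal n f).map φ = nashIdeal n (φ f) := by
  refine le_antisymm (map_nashIdeal_le φ f) fun x hx => ?_
  have h := map_nashIdeal_le (n := n) φ.symm (φ f) (Ideal.mem_map_of_mem φ.symm hx)
  rw [AlgEquiv.symm_apply_apply] at h
  simpa using Ideal.mem_map_of_mem φ h

/-- By the product rule, the Taylor difference of `u f` is a multiple of that of `f` modulo `f`. -/
theorem nashIdeal_mul_le (u f : ConvergentSeries d) : nashIdeal n (u * f) ≤ nashIdeal n f := by
  have hf : f ∈ Ideal.span {f} := Ideal.mem_span_singleton_self f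
  refine sup_le ?_ ?_
  · rw [Ideal.span_singleton_le_iff_mem]
    exact Ideal.mem_sup_left (Ideal.mul_mem_left _ _ hf)
  · rw [minorIdeal_eq_multipleMinorIdeal, nashIdeal, minorIdeal_eq_multipleMinorIdeal]
    have h : taylorDiff n (u * f) =
        taylorJet d n u * taylorDiff n f + f • taylorDiff n u := by
      simp only [taylorDiff, jetRing_smul_def, map_mul]
      ring
    rw [h]
    exact multipleMinorIdeal_mul_add_smul_le _ _ _ _ _ hf

theorem nashIdeal_unit_mul (u : (ConvergentSeries d)ˣ) (f : ConvergentSeries d) :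
    nashIdeal n ((u : ConvergentSeries d) * f) = nashIdeal n f := by
  refine le_antisymm (nashIdeal_mul_le _ _) ?_
  have h := nashIdeal_mul_le (n := n) (↑u⁻¹ : ConvergentSeries d) (u * f)
  rwa [Units.inv_mul_cancel_left] at h

end Order

variable {d : ℕ}

/-! ### The relations between the powers of `δx` in the module of differentials -/

/-- A polynomial as an element of the `ℂ[t]`-algebra `Total f`. -/
def toTotal (f : MvPolynomial (Fin d) ℂ) : MvPolynomial (Fin d) ℂ ≃+* Total f := RingEquiv.refl _

theorem toTotal_X (f : MvPolynomial (Fin d) ℂ) (i : Fin d) :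
    toTotal f (MvPolynomial.X i) = coord f i := rfl

theorem toTotal_C (f : MvPolynomial (Fin d) ℂ) (c : ℂ) :
    toTotal f (MvPolynomial.C c) = algebraMap (Polynomial ℂ) (Total f) (Polynomial.C c) :=
  (Polynomial.aeval_C f c).symm

theorem algebraMap_X_total (f : MvPolynomial (Fin d) ℂ) :
    algebraMap (Polynomial ℂ) (Total f) Polynomial.X = toTotal f f :=
  Polynomial.aeval_X f

/-- The truncated Taylor expansion of polynomials. -/
def polyTaylor (n : ℕ) (f : MvPolynomial (Fin d) ℂ) :
    MvPolynomial (Fin d) ℂ →+* JetRing d n (Total f) :=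
  MvPolynomial.eval₂Hom
    ((algebraMap (Total f) (JetRing d n (Total f))).comp
      ((toTotal f : MvPolynomial (Fin d) ℂ →+* Total f).comp MvPolynomial.C))
    fun i => algebraMap _ _ (coord f i) + jetX n (Total f) i

theorem polyTaylor_C (n : ℕ) (f : MvPolynomial (Fin d) ℂ) (c : ℂ) :
    polyTaylor n f (MvPolynomial.C c) = algebraMap _ _ (toTotal f (MvPolynomial.C c)) :=
  MvPolynomial.eval₂_C _ _ c

theorem polyTaylor_X (n : ℕ) (f : MvPolynomial (Fin d) ℂ) (i : Fin d) :
    polyTaylor n f (MvPolynomial.X i) = algebraMap _ _ (coord f i) + jetX n (Total f) i :=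
  MvPolynomial.eval₂_X _ _ i

theorem jetCoeff_zero_polyTaylor (n : ℕ) (f p : MvPolynomial (Fin d) ℂ) :
    jetCoeff 0 (by simp) (polyTaylor n f p) = toTotal f p := by
  classical
  induction p using MvPolynomial.induction_on with
  | C c => rw [polyTaylor_C, jetCoeff_algebraMap, if_pos rfl]
  | add p q hp hq => rw [map_add, map_add, map_add, hp, hq]
  | mul_X p i hp =>
    have h : jetCoeff 0 (by simp) (jetX n (Total f) i) = 0 :=
      MvPolynomial.coeff_zero_X i
    rw [map_mul (polyTaylor n f), jetCoeff_zero_mul_eq, hp, polyTaylor_X, map_add,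
      jetCoeff_algebraMap, if_pos rfl, h, add_zero, map_mul, toTotal_X]

/-- The truncated Taylor expansion of `f(x + δ) - f(x)` for a polynomial `f`. -/
def polyTaylorDiff (n : ℕ) (f : MvPolynomial (Fin d) ℂ) : JetRing d n (Total f) :=
  polyTaylor n f f - algebraMap _ _ (toTotal f f)

theorem jetCoeff_zero_polyTaylorDiff (n : ℕ) (f : MvPolynomial (Fin d) ℂ) :
    jetCoeff 0 (by simp) (polyTaylorDiff n f) = 0 := by
  classical
  rw [polyTaylorDiff, map_sub, jetCoeff_zero_polyTaylor, jetCoeff_algebraMap, if_pos rfl, sub_self]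

theorem deltaEval_X (n : ℕ) (f : MvPolynomial (Fin d) ℂ) (i : Fin d) :
    deltaEval n f (MvPolynomial.X i) = Ideal.Quotient.mk (diagonalIdeal f ^ (n + 1)) (delta f i) :=
  MvPolynomial.aeval_X _ i

theorem deltaEval_C (n : ℕ) (f : MvPolynomial (Fin d) ℂ) (a : Total f) :
    deltaEval n f (MvPolynomial.C a) =
      Ideal.Quotient.mk (diagonalIdeal f ^ (n + 1)) (a ⊗ₜ[Polynomial ℂ] 1) := by
  rw [deltaEval, MvPolynomial.aeval_C]
  rfl

theorem deltaEval_eq_zero_of_mem_pow (n : ℕ) (f : MvPolynomial (Fin d) ℂ)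
    (p : MvPolynomial (Fin d) (Total f))
    (hp : p ∈ MvPolynomial.idealOfVars (Fin d) (Total f) ^ (n + 1)) : deltaEval n f p = 0 := by
  have h1 : ∀ a ∈ Set.range (MvPolynomial.X : Fin d → MvPolynomial (Fin d) (Total f)),
      (deltaEval n f).toRingHom a ∈
      (diagonalIdeal f).map (Ideal.Quotient.mk (diagonalIdeal f ^ (n + 1))) := by
    rintro _ ⟨i, rfl⟩
    change deltaEval n f (MvPolynomial.X i) ∈ _
    rw [deltaEval_X]
    exact Ideal.mem_map_of_mem _
      (KaehlerDifferential.one_smul_sub_smul_one_mem_ideal (Polynomial ℂ) (coord f i))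
  have h2 := map_mem_pow_of_span_eq _ rfl h1 (n + 1) hp
  rwa [map_quotientMk_self_pow, Ideal.mem_bot] at h2

/-- The homomorphism `R[δ] / (δ)^(n+1) → (R ⊗[ℂ[t]] R) / I^(n+1)`, `δ_i ↦ 1 ⊗ x_i - x_i ⊗ 1`. -/
def jetToParts (n : ℕ) (f : MvPolynomial (Fin d) ℂ) :
    JetRing d n (Total f) →+* PrincipalParts n f :=
  Ideal.Quotient.lift _ (deltaEval n f).toRingHom (deltaEval_eq_zero_of_mem_pow n f)

theorem jetToParts_algebraMap (n : ℕ) (f : MvPolynomial (Fin d) ℂ) (a : Total f) :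
    jetToParts n f (algebraMap _ _ a) =
      Ideal.Quotient.mk (diagonalIdeal f ^ (n + 1)) (a ⊗ₜ[Polynomial ℂ] 1) :=
  deltaEval_C n f a

theorem jetToParts_jetX (n : ℕ) (f : MvPolynomial (Fin d) ℂ) (i : Fin d) :
    jetToParts n f (jetX n _ i) = Ideal.Quotient.mk (diagonalIdeal f ^ (n + 1)) (delta f i) :=
  deltaEval_X n f i

theorem jetToParts_polyTaylor (n : ℕ) (f p : MvPolynomial (Fin d) ℂ) :
    jetToParts n f (polyTaylor n f p) =
      Ideal.Quotient.mk (diagonalIdeal f ^ (n + 1)) (1 ⊗ₜ[Polynomial ℂ] toTotal f p) := by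
  have h : (jetToParts n f).comp (polyTaylor n f) =
      ((Ideal.Quotient.mk (diagonalIdeal f ^ (n + 1))).comp
        (Algebra.TensorProduct.includeRight :
          Total f →ₐ[Polynomial ℂ] Total f ⊗[Polynomial ℂ] Total f).toRingHom).comp
        (toTotal f : MvPolynomial (Fin d) ℂ →+* Total f) := by
    refine MvPolynomial.ringHom_ext (fun c => ?_) fun i => ?_
    · rw [RingHom.comp_apply, polyTaylor_C, jetToParts_algebraMap, toTotal_C,
        ← Algebra.TensorProduct.algebraMap_apply, Algebra.TensorProduct.algebraMap_apply']
      exact congrArg (fun a => Ideal.Quotient.mk (diagonalIdeal f ^ (n + 1))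
        (1 ⊗ₜ[Polynomial ℂ] a)) (toTotal_C f c).symm
    · rw [RingHom.comp_apply, polyTaylor_X, map_add, jetToParts_algebraMap, jetToParts_jetX,
        ← map_add, delta, add_sub_cancel]
      rfl
  exact RingHom.congr_fun h p

theorem jetToParts_polyTaylorDiff (n : ℕ) (f : MvPolynomial (Fin d) ℂ) :
    jetToParts n f (polyTaylorDiff n f) = 0 := by
  rw [polyTaylorDiff, map_sub, jetToParts_polyTaylor, jetToParts_algebraMap, ← algebraMap_X_total,
    ← Algebra.TensorProduct.algebraMap_apply', ← Algebra.TensorProduct.algebraMap_apply, sub_self]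

/-- The quotient of `R[δ] / (δ)^(n+1)` by `f(x + δ) - f(x)`. -/
abbrev RelativeJetRing (n : ℕ) (f : MvPolynomial (Fin d) ℂ) : Type :=
  JetRing d n (Total f) ⧸ Ideal.span {polyTaylorDiff n f}

/-- The Taylor expansion is a homomorphism of `ℂ[t]`-algebras modulo `f(x + δ) - f(x)`. -/
def relativeTaylor (n : ℕ) (f : MvPolynomial (Fin d) ℂ) :
    Total f →ₐ[Polynomial ℂ] RelativeJetRing n f where
  __ := ((Ideal.Quotient.mk (Ideal.span {polyTaylorDiff n f})).comp (polyTaylor n f)).comp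
    ((toTotal f).symm : Total f →+* MvPolynomial (Fin d) ℂ)
  commutes' p := by
    have h : (((Ideal.Quotient.mk (Ideal.span {polyTaylorDiff n f})).comp (polyTaylor n f)).comp
        ((toTotal f).symm : Total f →+* MvPolynomial (Fin d) ℂ)).comp
          (algebraMap (Polynomial ℂ) (Total f)) =
        ((Ideal.Quotient.mk (Ideal.span {polyTaylorDiff n f})).comp
          (algebraMap (Total f) (JetRing d n (Total f)))).comp
          (algebraMap (Polynomial ℂ) (Total f)) := by
      refine Polynomial.ringHom_ext (fun c => ?_) ?_
      · simp only [RingHom.comp_apply]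
        rw [← toTotal_C]
        exact congrArg _ (polyTaylor_C n f c)
      · simp only [RingHom.comp_apply]
        rw [algebraMap_X_total, Ideal.Quotient.eq]
        exact Ideal.mem_span_singleton_self _
    exact RingHom.congr_fun h p

/-- The homomorphism `R ⊗[ℂ[t]] R → R[δ] / ((δ)^(n+1), f(x + δ) - f(x))`,
`a ⊗ b ↦ a(x) b(x + δ)`. -/
def tensorToJet (n : ℕ) (f : MvPolynomial (Fin d) ℂ) :
    Total f ⊗[Polynomial ℂ] Total f →ₐ[Polynomial ℂ] RelativeJetRing n f :=
  Algebra.TensorProduct.productMap (S := RelativeJetRing n f)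
    (IsScalarTower.toAlgHom (Polynomial ℂ) (Total f) (RelativeJetRing n f)) (relativeTaylor n f)

theorem tensorToJet_tmul (n : ℕ) (f : MvPolynomial (Fin d) ℂ) (a b : Total f) :
    tensorToJet n f (a ⊗ₜ b) = Ideal.Quotient.mk _
      (algebraMap _ _ a * polyTaylor n f ((toTotal f).symm b)) :=
  Algebra.TensorProduct.productMap_apply_tmul _ _ a b

theorem tensorToJet_eq_zero_of_mem_pow (n : ℕ) (f : MvPolynomial (Fin d) ℂ)
    (z : Total f ⊗[Polynomial ℂ] Total f) (hz : z ∈ diagonalIdeal f ^ (n + 1)) :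
    tensorToJet n f z = 0 := by
  have h1 : ∀ w ∈ Set.range fun b : Total f => (1 : Total f) ⊗ₜ[Polynomial ℂ] b - b ⊗ₜ 1,
      (tensorToJet n f).toRingHom w ∈
      ((MvPolynomial.idealOfVars (Fin d) (Total f)).map (Ideal.Quotient.mk
        (MvPolynomial.idealOfVars (Fin d) (Total f) ^ (n + 1)))).map
          (Ideal.Quotient.mk (Ideal.span {polyTaylorDiff n f})) := by
    rintro _ ⟨b, rfl⟩
    change tensorToJet n f (1 ⊗ₜ b - b ⊗ₜ 1) ∈ _
    rw [map_sub, tensorToJet_tmul, tensorToJet_tmul, ← map_sub, map_one, map_one, map_one, one_mul,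
      mul_one]
    refine Ideal.mem_map_of_mem _ (mem_map_idealOfVars_of_jetCoeff_zero _ ?_)
    classical
    rw [map_sub, jetCoeff_zero_polyTaylor, jetCoeff_algebraMap, if_pos rfl,
      RingEquiv.apply_symm_apply, sub_self]
  have h2 := map_mem_pow_of_span_eq (B := RelativeJetRing n f) (tensorToJet n f).toRingHom
    (KaehlerDifferential.span_range_eq_ideal (Polynomial ℂ) (Total f)) h1 (n + 1) hz
  exact (Ideal.mem_bot (R := RelativeJetRing n f)).mp
    ((map_map_quotientMk_self_pow _ _ _).le h2)

/-- The algebra of principal parts is the quotient of `R[δ] / (δ)^(n+1)` by `f(x + δ) - f(x)`. -/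
theorem jetToParts_eq_zero_iff (n : ℕ) (f : MvPolynomial (Fin d) ℂ) (x : JetRing d n (Total f)) :
    jetToParts n f x = 0 ↔ ∃ p, x = p * polyTaylorDiff n f := by
  constructor
  · intro hx
    have h : (Ideal.Quotient.lift (diagonalIdeal f ^ (n + 1)) (tensorToJet n f).toRingHom
        (tensorToJet_eq_zero_of_mem_pow n f)).comp (jetToParts n f) =
          Ideal.Quotient.mk (Ideal.span {polyTaylorDiff n f}) := by
      refine jetRing_ringHom_ext (L := RelativeJetRing n f) (fun a => ?_) fun i => ?_
      · rw [RingHom.comp_apply, jetToParts_algebraMap, Ideal.Quotient.lift_mk]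
        change tensorToJet n f _ = _
        rw [tensorToJet_tmul, map_one, map_one, mul_one]
      · rw [RingHom.comp_apply, jetToParts_jetX, Ideal.Quotient.lift_mk]
        change tensorToJet n f _ = _
        rw [delta, map_sub, tensorToJet_tmul, tensorToJet_tmul, ← map_sub, map_one, map_one,
          map_one, one_mul, mul_one, ← toTotal_X, RingEquiv.symm_apply_apply, polyTaylor_X,
          toTotal_X, add_sub_cancel_left]
    have h2 := RingHom.congr_fun h x
    rw [RingHom.comp_apply, hx, map_zero] at h2
    obtain ⟨p, hp⟩ := Ideal.mem_span_singleton'.mp (Ideal.Quotient.eq_zero_iff_mem.mp h2.symm)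
    exact ⟨p, hp.symm⟩
  · rintro ⟨p, rfl⟩
    rw [map_mul, jetToParts_polyTaylorDiff, mul_zero]

theorem jetToParts_jetMonomial (n : ℕ) (f : MvPolynomial (Fin d) ℂ) (a : ColIndex d n) :
    jetToParts n f (jetMonomial n _ a.1) = (deltaClass n f a : PrincipalParts n f) := by
  change deltaEval n f (MvPolynomial.monomial a.1 1) = Ideal.Quotient.mk _ (deltaPow f a.1)
  rw [deltaEval, MvPolynomial.aeval_monomial, map_one, one_mul, deltaPow, map_prod,
    Finsupp.prod_fintype _ _ fun _ => pow_zero _]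
  simp only [map_pow]

/-- The rows of `jetMatrix (polyTaylorDiff n f)` generate the relations between the classes
`(δx)^a`. -/
theorem sum_smul_deltaClass_eq_zero_iff (n : ℕ) (f : MvPolynomial (Fin d) ℂ)
    (c : ColIndex d n → Total f) :
    ∑ a, c a • deltaClass n f a = 0 ↔ ∃ p : RowIndex d n → Total f,
      ∀ a, c a = ∑ b, p b * jetMatrix (polyTaylorDiff n f) b a := by
  classical
  have h0 := jetCoeff_zero_polyTaylorDiff n f
  have hsum : ((∑ a, c a • deltaClass n f a : higherOmega n f) : PrincipalParts n f) =
      jetToParts n f (∑ a, c a • jetMonomial n _ a.1) := by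
    rw [AddSubmonoidClass.coe_finsetSum, map_sum]
    refine Finset.sum_congr rfl fun a _ => ?_
    rw [jetRing_smul_def, map_mul, jetToParts_jetMonomial, jetToParts_algebraMap]
    exact Algebra.smul_def (c a) (deltaClass n f a : PrincipalParts n f)
  have hcoeff : ∀ a : ColIndex d n,
      jetCoeff a.1 a.2.2 (∑ a, c a • jetMonomial n (Total f) a.1) = c a := by
    intro a
    rw [map_sum, Finset.sum_eq_single a]
    · rw [map_smul, jetCoeff_jetMonomial, if_pos rfl, smul_eq_mul, mul_one]
    · intro b _ hb
      rw [map_smul, jetCoeff_jetMonomial, if_neg fun h => hb (Subtype.ext h), smul_zero]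
    · simp
  rw [← Submodule.coe_eq_zero, hsum, jetToParts_eq_zero_iff]
  constructor
  · rintro ⟨p, hp⟩
    refine ⟨fun b => jetCoeff b.1 b.2.le p, fun a => ?_⟩
    rw [← jetCoeff_mul_of_constant_eq_zero _ _ h0, ← hp, hcoeff]
  · rintro ⟨p, hp⟩
    refine ⟨∑ b : RowIndex d n, p b • jetMonomial n _ b.1, ?_⟩
    rw [eq_sum_jetMonomial _ (jetCoeff_zero_mul (∑ b : RowIndex d n, p b • jetMonomial n _ b.1)
      _ h0)]
    refine Finset.sum_congr rfl fun a _ => ?_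
    rw [jetCoeff_mul_of_constant_eq_zero _ _ h0, hp a]
    congr 1
    refine Finset.sum_congr rfl fun b _ => ?_
    congr 1
    rw [map_sum, Finset.sum_eq_single b]
    · rw [map_smul, jetCoeff_jetMonomial, if_pos rfl, smul_eq_mul, mul_one]
    · intro b' _ hb
      rw [map_smul, jetCoeff_jetMonomial, if_neg fun h => hb (Subtype.ext h), smul_zero]
    · simp

/-! ### The Fitting ideal as an ideal of maximal minors -/

/-- The size of the minors in the Fitting ideal equals the number of rows of `Jac_n(f)`. -/
theorem card_colIndex_add_one (d n : ℕ) (hd : 1 ≤ d) :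
    Fintype.card (ColIndex d n) + 1 = Fintype.card (RowIndex d n) + (d - 1 + n).choose (d - 1) := by
  classical
  set T : Finset (Fin d →₀ ℕ) := (Finsupp.finite_of_degree_le n).toFinset with hT
  have hmem : ∀ a, a ∈ T ↔ a.degree ≤ n := fun a => by simp [hT]
  have hcol : Fintype.card (ColIndex d n) = (T.filter fun a => 1 ≤ a.degree).card :=
    Fintype.card_of_subtype _ fun a => by rw [Finset.mem_filter, hmem, and_comm]
  have hrow : Fintype.card (RowIndex d n) = (T.filter fun a => a.degree < n).card :=
    Fintype.card_of_subtype _ fun a => by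
      rw [Finset.mem_filter, hmem, and_iff_right_iff_imp]
      exact le_of_lt
  have h0 : (T.filter fun a => ¬ 1 ≤ a.degree) = {0} := by
    ext a
    rw [Finset.mem_filter, hmem, Finset.mem_singleton, not_le, Nat.lt_one_iff,
      ← Finsupp.degree_eq_zero_iff]
    omega
  have hn : (T.filter fun a => ¬ a.degree < n) = Finset.univ.finsuppAntidiag n := by
    ext a
    rw [Finset.mem_filter, hmem, Finset.mem_finsuppAntidiag, ← Finsupp.degree_eq_sum]
    simp only [Finset.subset_univ, and_true]
    omega
  have h1 := Finset.card_filter_add_card_filter_not (s := T) fun a => 1 ≤ a.degree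
  have h2 := Finset.card_filter_add_card_filter_not (s := T) fun a => a.degree < n
  rw [h0, Finset.card_singleton] at h1
  rw [hn, Finset.card_finsuppAntidiag_nat_eq_choose, Finset.card_univ, Fintype.card_fin] at h2
  have h3 : d + n - 1 = d - 1 + n := by omega
  rw [hcol, hrow, h1, ← h2, h3, Nat.choose_symm_add]

/-- If the relations of a finite family are generated by the rows of `A`, then the Fitting ideal
whose minors have as many rows as `A` is generated by the maximal minors of `A`. -/
theorem fittingIdeal_eq_maximalMinorIdeal {R M ι κ : Type*} [CommRing R] [AddCommGroup M]
    [Module R M] [Fintype ι] [Fintype κ] [DecidableEq κ] (v : ι → M)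
    (hv : Submodule.span R (Set.range v) = ⊤) (A : Matrix κ ι R)
    (hA : ∀ c : ι → R, ∑ a, c a • v a = 0 ↔ ∃ p : κ → R, ∀ a, c a = ∑ b, p b * A b a)
    (i : ℕ) (hi : Fintype.card ι - i = Fintype.card κ) :
    fittingIdeal v hv i = maximalMinorIdeal A := by
  classical
  let e : Fin (Fintype.card ι - i) ≃ κ := Fintype.equivOfCardEq (by simp [hi])
  apply le_antisymm
  · rw [fittingIdeal, Ideal.span_le]
    rintro _ ⟨s, c, hc, rfl⟩
    choose p hp using fun k => (hA (c k)).mp (hc k)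
    have h : (Matrix.of fun k l => c k (s l)).submatrix e.symm e.symm =
        (Matrix.of fun k b => p (e.symm k) b) * A.submatrix id (e.symm.toEmbedding.trans s) := by
      ext k l
      simp only [Matrix.submatrix_apply, Matrix.of_apply, hp, Matrix.mul_apply]
      rfl
    -- as the relations are as many as the rows of `A`, the coefficients form a square matrix
    rw [← Matrix.det_submatrix_equiv_self e.symm, h, Matrix.det_mul]
    exact Ideal.mul_mem_left _ _ (Ideal.subset_span ⟨_, rfl⟩)
  · rw [maximalMinorIdeal, Ideal.span_le]
    rintro _ ⟨s, rfl⟩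
    refine Ideal.subset_span ⟨e.toEmbedding.trans s, fun k => A (e k), fun k => ?_, ?_⟩
    · exact (hA _).mpr ⟨Pi.single (e k) 1, fun a => by simp [Pi.single_apply]⟩
    · dsimp only
      rw [← Matrix.det_submatrix_equiv_self e]
      rfl

open Classical in
theorem higherJacobianIdeal_eq (n : ℕ) (hd : 1 ≤ d) (f : MvPolynomial (Fin d) ℂ) :
    higherJacobianIdeal n f =
      (maximalMinorIdeal (jetMatrix (polyTaylorDiff n f)) : Ideal (Total f)) := by
  refine fittingIdeal_eq_maximalMinorIdeal _ (span_deltaClass n f) _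
    (sum_smul_deltaClass_eq_zero_iff n f) _ ?_
  have h := card_colIndex_add_one d n hd
  have h2 : 0 < (d - 1 + n).choose (d - 1) := Nat.choose_pos (Nat.le_add_right _ _)
  omega

theorem jetCoeff_jetEval_jetX {n : ℕ} {K L : Type*} [CommRing K] [CommRing L] (φ : K →+* L)
    (h : ∀ i, jetCoeff 0 (by simp) (jetX n L i : JetRing d n L) = 0) (a : Fin d →₀ ℕ)
    (ha : a.degree ≤ n) (x : JetRing d n K) :
    jetCoeff a ha (jetEval φ (jetX n L) h x) = φ (jetCoeff a ha x) := by
  obtain ⟨p, rfl⟩ := Ideal.Quotient.mk_surjective x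
  have h1 : jetEval φ (jetX n L) h (Ideal.Quotient.mk _ p) =
      Ideal.Quotient.mk _ (MvPolynomial.map φ p) := by
    have h2 : (jetEval φ (jetX n L) h).comp (Ideal.Quotient.mk _) =
        (Ideal.Quotient.mk (MvPolynomial.idealOfVars (Fin d) L ^ (n + 1))).comp
          (MvPolynomial.map φ) := by
      refine MvPolynomial.ringHom_ext (fun c => ?_) fun i => ?_
      · rw [RingHom.comp_apply, RingHom.comp_apply, MvPolynomial.map_C]
        exact jetEval_algebraMap φ _ h c
      · rw [RingHom.comp_apply, RingHom.comp_apply, MvPolynomial.map_X]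
        exact jetEval_jetX φ _ h i
    exact RingHom.congr_fun h2 p
  rw [h1, jetCoeff_mk, jetCoeff_mk, MvPolynomial.coeff_map]

/-- The inclusion of polynomials into convergent power series, on `Total f`. -/
def totalToSeries (f : MvPolynomial (Fin d) ℂ) : Total f →+* ConvergentSeries d :=
  (polyToSeries d).toRingHom.comp ((toTotal f).symm : Total f →+* MvPolynomial (Fin d) ℂ)

theorem jetMatrix_polyTaylorDiff_map (n : ℕ) (f : MvPolynomial (Fin d) ℂ) :
    (jetMatrix (polyTaylorDiff n f)).map (totalToSeries f) =
      jetMatrix (taylorDiff n (polyToSeries d f)) := by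
  classical
  have h0 : ∀ i : Fin d, jetCoeff 0 (by simp) (jetX n (ConvergentSeries d) i) = 0 := fun i =>
    MvPolynomial.coeff_zero_X i
  have h1 : (jetEval (totalToSeries f) (jetX n _) h0).comp (polyTaylor n f) =
      (taylorJet d n).comp (polyToSeries d).toRingHom := by
    refine MvPolynomial.ringHom_ext (fun c => ?_) fun i => ?_
    · rw [RingHom.comp_apply, RingHom.comp_apply, polyTaylor_C, jetEval_algebraMap]
      have h2 : polyToSeries d (MvPolynomial.C c) = algebraMap ℂ _ c :=
        (polyToSeries d).commutes c
      change algebraMap _ _ (polyToSeries d (MvPolynomial.C c)) =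
        taylorJet d n (polyToSeries d (MvPolynomial.C c))
      rw [h2, taylorJet_algebraMap]
    · rw [RingHom.comp_apply, RingHom.comp_apply, polyTaylor_X, map_add, jetEval_algebraMap,
        jetEval_jetX]
      exact (taylorJet_seriesX n i).symm
  have h2 : jetEval (totalToSeries f) (jetX n _) h0 (polyTaylorDiff n f) =
      taylorDiff n (polyToSeries d f) := by
    rw [polyTaylorDiff, map_sub, jetEval_algebraMap]
    exact congrArg₂ _ (RingHom.congr_fun h1 f) rfl
  ext1 b a
  rw [Matrix.map_apply, jetMatrix, jetMatrix, ← h2]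
  split_ifs with h
  · rw [jetCoeff_jetEval_jetX]
  · exact map_zero _

/-- The Jacobian ideal of order `n` and the maximal minors of `Jac_n(f)` generate the same ideal of
`ℂ{x}`. -/
theorem map_higherJacobianIdeal (n : ℕ) (hd : 1 ≤ d) (f : MvPolynomial (Fin d) ℂ) :
    (higherJacobianIdeal n f).map (polyToSeries d) = minorIdeal n (polyToSeries d f) := by
  classical
  rw [minorIdeal_eq, ← jetMatrix_polyTaylorDiff_map, ← map_maximalMinorIdeal,
    higherJacobianIdeal_eq n hd]
  rfl

end HigherNash

end

theorem corollary2 (d : ℕ) (hd : 1 ≤ d) (f g : MvPolynomial (Fin d) ℂ)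
    (hf : HigherNash.HasIsolatedSingularity f) (hg : HigherNash.HasIsolatedSingularity g)
    (hfg : HigherNash.ContactEquivalent (HigherNash.polyToSeries d f)
      (HigherNash.polyToSeries d g))
    (n : ℕ) (hn : 1 ≤ n) :
    Nonempty (HigherNash.NashBlowupLocalAlgebra n f ≃ₐ[ℂ]
      HigherNash.NashBlowupLocalAlgebra n g) ∧
    Nonempty (HigherNash.NashBlowupLocalAlgebraOfMinors n f ≃ₐ[ℂ]
      HigherNash.NashBlowupLocalAlgebraOfMinors n g) := by
  open HigherNash in
  obtain ⟨φ, u, hgf⟩ := hfg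
  have h : nashIdeal n (polyToSeries d g) = (nashIdeal n (polyToSeries d f)).map φ := by
    rw [hgf, nashIdeal_unit_mul, map_nashIdeal]
  refine ⟨⟨Ideal.quotientEquivAlg _ _ φ ?_⟩, ⟨Ideal.quotientEquivAlg _ _ φ h⟩⟩
  rw [map_higherJacobianIdeal n hd, map_higherJacobianIdeal n hd]
  exact h
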